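/- **Notation.** Let $c,r\ge 1$ and $k=r+c-1$ (so $k\ge 1$), and let $R=(c^r)$ be the rectangle with $r$ rows and $c$ columns. * $W$ is the affine symmetric group with generators $s_0,\dots,s_k$ (indices modulo $k+1$) and relations $s_i^2=1$, $s_is_j=s_js_i$ for $i-j\neq\pm1$, and, if $k\ge 2$, $s_is_{i+1}s_i=s_{i+1}s_is_{i+1}$. $W_0$ is the subgroup generated by $s_1,\dots,s_k$, and $W^0$ is the set of elements that have minimal length in their coset $wW_0$. * The affine nilCoxeter algebra $\mathbb A$ over a commutative ring $K$ has generators $u_0,\dots,u_k$ and relations $u_i^2=0$, $u_iu_j=u_ju_i$ for $i-j\ne\pm1$, and, if $k\ge 2$, $u_iu_{i+1}u_i=u_{i+1}u_iu_{i+1}$. For $w\in W$ with reduced word $s_{i_1}\cdots s_{i_m}$ put $\mathbf u(w)=u_{i_1}\cdots u_{i_m}$. * $W$ acts on $V=\mathbb R^{k+1}/\mathbb R(1,\dots,1)$ in two ways. For $i\ne0$, $s_i\diamond a=s_i\star a$ is $a$ with $a_i$ and $a_{i+1}$ exchanged, while $s_0\diamond(a_1,\dots,a_{k+1})=(a_{k+1}+1,a_2,\dots,a_k,a_1-1)$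 and $s_0\star(a_1,\dots,a_{k+1})=(a_{k+1},a_2,\dots,a_k,a_1)$. * $A_\emptyset=\{a\in V: a_1\ge a_2\ge\dots\ge a_{k+1}\ge a_1-1\}$ and $A_w=w^{-1}\diamond A_\emptyset$. Let $\Gamma\subset V$ be the set of classes of the $0/1$ vectors with exactly $c$ ones, and let $\Lambda_c=(1^c,0^{r})\in\Gamma$. For $\gamma\in\Gamma$, $z_\gamma\in W$ is the element with $A_{z_\gamma}=A_\emptyset+\gamma$. * The content of the cell in row $i$ and column $j$ is $j-i$ modulo $k+1$. $W$ acts on $(k+1)$-cores: $s_i$ adds all addable cells of content $i$ if there are any, removes all removable cells of content $i$ if there are any, and otherwise does nothing. Let $\mathfrak R$ be the set of partitions $\nu\subseteq R$ (each is a $(k+1)$-core). For $\nu\in\mathfrak R$, $w_\nu$ is the element of $W^0$ with $w_\nu\emptyset=\nu$. * For $\nu\in\mathfrak R$, $(R,\nu)$ is the partition whose rows are the $r$ rows of $R$ followed by the rows of $\nu$, and $V_{(R,\nu)/\nu}\in W$ is the product of the $s_i$ along the contents of the cells of $(R,\nu)/\nu$, read row by row from the last (shortest) row of $(R,\nu)$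 to the first, each row from right to left. Put $$X_R=\sum_{\nu\in\mathfrak R}\mathbf u\bigl(V_{(R,\nu)/\nu}\bigr),\qquad Y_R=\sum_{\gamma\in\Gamma}\mathbf u(z_\gamma).$$ **Theorem.** $X_R=Y_R$ in $\mathbb A$. More precisely, $w_\nu$ (for $\nu\in\mathfrak R$) and $z_\gamma$ (for $\gamma\in\Gamma$) exist and are unique, the map $\psi(\nu)=w_\nu\star\Lambda_c$ is a bijection from $\mathfrak R$ onto $\Gamma$, and $V_{(R,\nu)/\nu}=z_{\psi(\nu)}$ for every $\nu\in\mathfrak R$. -/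

import Mathlib

namespace AffineA

/-! The affine symmetric group `W` of type `A_k^{(1)}`. Residues modulo `k + 1` index its generators. -/

/-- The Coxeter matrix of affine type A with generators `s_0, …, s_k`: neighbours modulo `k + 1`
satisfy the braid relation of length 3, other pairs commute. For `k = 1` the two generators satisfy
no relation besides `s_i ^ 2 = 1` (in Mathlib the entry `0` stands for `∞`). -/
def coxeterMatrix (k : ℕ) : CoxeterMatrix (ZMod (k + 1)) where
  M := Matrix.of fun i j =>
    if i = j then 1 else if i - j = 1 ∨ j - i = 1 then (if k = 1 then 0 else 3) else 2
  isSymm := by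
    ext i j
    simp only [Matrix.transpose_apply, Matrix.of_apply, eq_comm (a := i) (b := j),
      or_comm (a := i - j = 1)]
  diagonal i := by simp
  off_diagonal i j h := by
    simp only [Matrix.of_apply, if_neg h]
    split_ifs <;> decide

/-- A criterion for a map on the generators to extend to the affine symmetric group. -/
theorem isLiftable {k : ℕ} {G : Type*} [Group G] (f : ZMod (k + 1) → G)
    (sq : ∀ i, f i * f i = 1)
    (comm : ∀ i j, i - j ≠ 1 → j - i ≠ 1 → f i * f j = f j * f i)
    (braid : 2 ≤ k → ∀ i, f i * f (i + 1) * f i = f (i + 1) * f i * f (i + 1)) :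
    (coxeterMatrix k).IsLiftable f := by
  have br : ∀ a b : G, a * a = 1 → b * b = 1 → a * b * a = b * a * b → (a * b) ^ 3 = 1 := by
    intro a b ha hb hab
    calc (a * b) ^ 3 = (a * b * a) * (b * a * b) := by simp only [pow_succ, pow_zero, one_mul, mul_assoc]
      _ = (b * a * b) * (b * a * b) := by rw [hab]
      _ = b * a * (b * b) * a * b := by simp only [mul_assoc]
      _ = b * (a * a) * b := by rw [hb, mul_one]; simp only [mul_assoc]
      _ = 1 := by rw [ha, mul_one, hb]
  intro i j
  change (f i * f j) ^ (if i = j then 1 else if i - j = 1 ∨ j - i = 1 then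
    (if k = 1 then 0 else 3) else 2) = 1
  split_ifs with h1 h2 h3
  · subst h1; simpa using sq i
  · simp
  · have hk : 2 ≤ k := by
      by_contra hk
      obtain rfl : k = 0 := by omega
      exact h1 (Subsingleton.elim (α := Fin 1) i j)
    rcases h2 with h | h
    · obtain rfl : i = j + 1 := by rw [← h]; ring
      exact br _ _ (sq _) (sq _) (braid hk j).symm
    · obtain rfl : j = i + 1 := by rw [← h]; ring
      exact br _ _ (sq _) (sq _) (braid hk i)
  · push Not at h2
    rw [pow_two, comm i j h2.1 h2.2]
    calc f j * f i * (f j * f i) = f j * f i * (f i * f j) := by rw [comm i j h2.1 h2.2]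
      _ = f j * (f i * f i) * f j := by simp only [mul_assoc]
      _ = 1 := by rw [sq, mul_one, sq]

/-- The affine symmetric group `W`, generated by the `s_i` subject to the Coxeter relations. -/
abbrev AffineWeyl (k : ℕ) : Type := (coxeterMatrix k).Group

/-- `W` with its simple reflections; it supplies words, length and reduced words. -/
def coxSys (k : ℕ) : CoxeterSystem (coxeterMatrix k) (AffineWeyl k) :=
  (coxeterMatrix k).toCoxeterSystem

/-- The parabolic subgroup `W_0` generated by the `s_i` with `i ≠ 0`. -/
def parabolic (k : ℕ) : Subgroup (AffineWeyl k) :=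
  Subgroup.closure ((coxSys k).simple '' {i | i ≠ 0})

/-- `W^0`: the elements of minimal length in their coset `w W_0`. -/
def minReps (k : ℕ) : Set (AffineWeyl k) :=
  {w | ∀ v ∈ parabolic k, (coxSys k).length w ≤ (coxSys k).length (w * v)}

/-! The space `V` and the two actions of `W` on it. The coordinate `a_{j+1}`, `0 ≤ j ≤ k`, of a
vector is stored at the residue `j`; so `a_1` sits at `0` and `a_{k+1}` at `-1 = k`. -/

/-- `V`, the quotient of `ℝ^{k+1}` by the line through `(1, …, 1)`. -/
abbrev VSpace (k : ℕ) : Type :=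
  (ZMod (k + 1) → ℝ) ⧸ Submodule.span ℝ {(fun _ => 1 : ZMod (k + 1) → ℝ)}

/-- The projection `ℝ^{k+1} → V`. -/
def toV (k : ℕ) : (ZMod (k + 1) → ℝ) →ₗ[ℝ] VSpace k := Submodule.mkQ _

/-- `s_i ⋆ a`: exchange the coordinates `a_i` and `a_{i+1}`; for `i = 0`, exchange `a_{k+1}` and
`a_1`. -/
noncomputable def starGen (k : ℕ) (i : ZMod (k + 1)) : VSpace k ≃ₗ[ℝ] VSpace k :=
  Submodule.Quotient.equiv _ _ (LinearEquiv.funCongrLeft ℝ ℝ (Equiv.swap (i - 1) i)) (by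
    rw [Submodule.map_span, Set.image_singleton]; rfl)

/-- The translation part of `s_0 ⋄`, namely `(1, 0, …, 0, -1)`; it is zero for `i ≠ 0`. -/
noncomputable def shift (k : ℕ) (i : ZMod (k + 1)) : ZMod (k + 1) → ℝ :=
  if i = 0 then Pi.single 0 1 - Pi.single (-1) 1 else 0

/-- `s_i ⋄ a`: exchange `a_i` and `a_{i+1}` for `i ≠ 0`, and
`s_0 ⋄ (a_1, …, a_{k+1}) = (a_{k+1} + 1, a_2, …, a_k, a_1 - 1)`. -/
noncomputable def diamondGen (k : ℕ) (i : ZMod (k + 1)) : Equiv.Perm (VSpace k) :=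
  (starGen k i).toEquiv.trans (Equiv.addRight (toV k (shift k i)))

theorem starGen_toV {k : ℕ} (i : ZMod (k + 1)) (a : ZMod (k + 1) → ℝ) :
    starGen k i (toV k a) = toV k fun x => a (Equiv.swap (i - 1) i x) := rfl

theorem diamondGen_toV {k : ℕ} (i : ZMod (k + 1)) (a : ZMod (k + 1) → ℝ) :
    diamondGen k i (toV k a) =
      toV k fun x => a (Equiv.swap (i - 1) i x) + shift k i x := rfl

/-- For `k ≥ 2` the residues `-1, 0, 1` modulo `k + 1` are distinct. -/
theorem one_ne {k : ℕ} (hk : 2 ≤ k) : (1 : ZMod (k + 1)) ≠ 0 ∧ (1 : ZMod (k + 1)) ≠ -1 := by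
  constructor
  · intro h
    have := (ZMod.natCast_eq_zero_iff 1 (k+1)).1 (by exact_mod_cast h)
    have := Nat.le_of_dvd one_pos this
    omega
  · intro h
    have := (ZMod.natCast_eq_zero_iff 2 (k+1)).1 (by push_cast; linear_combination h)
    have := Nat.le_of_dvd two_pos this
    omega

theorem starGen_sq {k : ℕ} (i : ZMod (k + 1)) : starGen k i * starGen k i = 1 := by
  ext x
  obtain ⟨a, rfl⟩ := Submodule.mkQ_surjective _ x
  change starGen k i (starGen k i (toV k a)) = toV k a
  simp [starGen_toV]

theorem starGen_comm {k : ℕ} (i j : ZMod (k + 1)) (h : i - j ≠ 1) (h' : j - i ≠ 1) :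
    starGen k i * starGen k j = starGen k j * starGen k i := by
  ext x
  obtain ⟨a, rfl⟩ := Submodule.mkQ_surjective _ x
  change starGen k i (starGen k j (toV k a)) = starGen k j (starGen k i (toV k a))
  simp only [starGen_toV]
  congr 1; funext x; congr 1
  simp only [Equiv.swap_apply_def]
  grind

theorem starGen_braid {k : ℕ} (hk : 2 ≤ k) (i : ZMod (k + 1)) :
    starGen k i * starGen k (i + 1) * starGen k i =
      starGen k (i + 1) * starGen k i * starGen k (i + 1) := by
  ext x
  obtain ⟨a, rfl⟩ := Submodule.mkQ_surjective _ x
  change starGen k i (starGen k (i + 1) (starGen k i (toV k a))) =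
    starGen k (i + 1) (starGen k i (starGen k (i + 1) (toV k a)))
  simp only [starGen_toV]
  congr 1; funext x; congr 1
  obtain ⟨h0, h1⟩ := one_ne hk
  simp only [Equiv.swap_apply_def]
  grind

theorem shift_apply {k : ℕ} (i x : ZMod (k + 1)) : shift k i x =
    if i = 0 then (if x = 0 then 1 else 0) - (if x = -1 then 1 else 0) else 0 := by
  unfold shift; split_ifs <;> simp_all

theorem diamondGen_sq {k : ℕ} (i : ZMod (k + 1)) : diamondGen k i * diamondGen k i = 1 := by
  ext x
  obtain ⟨a, rfl⟩ := Submodule.mkQ_surjective _ x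
  change diamondGen k i (diamondGen k i (toV k a)) = toV k a
  simp only [diamondGen_toV, shift_apply]
  congr 1; funext x
  simp only [Equiv.swap_apply_def]
  grind

theorem diamondGen_comm {k : ℕ} (i j : ZMod (k + 1)) (h : i - j ≠ 1) (h' : j - i ≠ 1) :
    diamondGen k i * diamondGen k j = diamondGen k j * diamondGen k i := by
  ext x
  obtain ⟨a, rfl⟩ := Submodule.mkQ_surjective _ x
  change diamondGen k i (diamondGen k j (toV k a)) = diamondGen k j (diamondGen k i (toV k a))
  simp only [diamondGen_toV, shift_apply]
  congr 1; funext x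
  simp only [Equiv.swap_apply_def]
  grind

theorem diamondGen_braid {k : ℕ} (hk : 2 ≤ k) (i : ZMod (k + 1)) :
    diamondGen k i * diamondGen k (i + 1) * diamondGen k i =
      diamondGen k (i + 1) * diamondGen k i * diamondGen k (i + 1) := by
  ext x
  obtain ⟨a, rfl⟩ := Submodule.mkQ_surjective _ x
  change diamondGen k i (diamondGen k (i + 1) (diamondGen k i (toV k a))) =
    diamondGen k (i + 1) (diamondGen k i (diamondGen k (i + 1) (toV k a)))
  simp only [diamondGen_toV, shift_apply]
  congr 1; funext x
  obtain ⟨h0, h1⟩ := one_ne hk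
  simp only [Equiv.swap_apply_def]
  grind

/-- The `⋆` action of `W` on `V`. -/
noncomputable def starAct (k : ℕ) : AffineWeyl k →* (VSpace k ≃ₗ[ℝ] VSpace k) :=
  (coxSys k).lift ⟨starGen k, isLiftable _ starGen_sq starGen_comm starGen_braid⟩

/-- The `⋄` action of `W` on `V`. -/
noncomputable def diamondAct (k : ℕ) : AffineWeyl k →* Equiv.Perm (VSpace k) :=
  (coxSys k).lift ⟨diamondGen k, isLiftable _ diamondGen_sq diamondGen_comm diamondGen_braid⟩

/-- The fundamental alcove `a_1 ≥ a_2 ≥ … ≥ a_{k+1} ≥ a_1 - 1`. -/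
def fundAlcove (k : ℕ) : Set (VSpace k) :=
  toV k '' {a | (∀ i j : ZMod (k + 1), i.val ≤ j.val → a j ≤ a i) ∧ a 0 - 1 ≤ a (-1)}

/-- The alcove `A_w = w⁻¹ ⋄ A_∅`. -/
def alcove (k : ℕ) (w : AffineWeyl k) : Set (VSpace k) := diamondAct k w⁻¹ '' fundAlcove k

/-- `y` is a pseudo-translation of `A_w` in direction `η`: `A_{yw} = A_w + η`. -/
def IsPseudoTranslation (k : ℕ) (y w : AffineWeyl k) (η : VSpace k) : Prop :=
  alcove k (y * w) = (fun v => v + η) '' alcove k w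

/-- `z_γ`: the pseudo-translation of the fundamental alcove in direction `γ`. -/
noncomputable def pseudoTrans (k : ℕ) (γ : VSpace k) : AffineWeyl k :=
  Classical.epsilon fun y => IsPseudoTranslation k y 1 γ

/-- `Γ`: the classes in `V` of the 0/1 vectors with `c` ones. -/
def Gam (k c : ℕ) : Set (VSpace k) :=
  toV k '' {a | (∀ i, a i = 0 ∨ a i = 1) ∧ ∑ i, a i = c}

theorem finite_Gam (k c : ℕ) : (Gam k c).Finite := by
  refine Set.Finite.image _ (Set.Finite.subset
    (Set.Finite.pi' (t := fun _ : ZMod (k + 1) => ({0, 1} : Set ℝ)) fun _ => Set.toFinite _) ?_)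
  rintro a ⟨h, -⟩ i
  simpa using h i

/-- `Λ_c = (1, …, 1, 0, …, 0)` with `c` ones. -/
def fundWeight (k c : ℕ) : VSpace k := toV k fun i => if i.val < c then 1 else 0

/-! Partitions, contents and the action of `W` by adding and removing boxes. Rows and columns of a
`YoungDiagram` are counted from 0, and the cell `(i, j)` lies in row `i` and column `j`. -/

/-- The content of a cell, column minus row, modulo `k + 1`. -/
def content (k : ℕ) (b : ℕ × ℕ) : ZMod (k + 1) := (b.2 : ZMod (k + 1)) - (b.1 : ZMod (k + 1))

/-- The cell `b` can be added to `μ`. -/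
def IsAddable (μ : YoungDiagram) (b : ℕ × ℕ) : Prop := b ∉ μ ∧ ∀ d, d < b → d ∈ μ

/-- The cell `b` can be removed from `μ`. -/
def IsRemovable (μ : YoungDiagram) (b : ℕ × ℕ) : Prop := b ∈ μ ∧ ∀ d, b < d → d ∉ μ

/-- The cells of `s_i μ`: all removable cells of content `i` are removed and all addable cells of
content `i` are added. A `(k+1)`-core never has both an addable and a removable cell of the same
content, so on cores this adds all addable cells if there are any, removes all removable cells if
there are any, and changes nothing otherwise. -/
def reflectCells (k : ℕ) (i : ZMod (k + 1)) (μ : YoungDiagram) : Set (ℕ × ℕ) :=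
  {b | (b ∈ μ ∧ ¬ (IsRemovable μ b ∧ content k b = i)) ∨ (IsAddable μ b ∧ content k b = i)}

theorem isAddable_iff {μ : YoungDiagram} {r j : ℕ} :
    IsAddable μ (r, j) ↔ j = μ.rowLen r ∧ (r = 0 ∨ μ.rowLen r < μ.rowLen (r - 1)) := by
  constructor
  · rintro ⟨h, h'⟩
    rw [YoungDiagram.mem_iff_lt_rowLen] at h
    have e : j = μ.rowLen r := by
      refine le_antisymm ?_ (not_lt.1 h)
      rcases j with _ | j
      · exact Nat.zero_le _
      · have := h' (r, j) (Prod.mk_lt_mk.2 (Or.inr ⟨le_rfl, Nat.lt_succ_self j⟩))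
        rw [YoungDiagram.mem_iff_lt_rowLen] at this
        exact this
    refine ⟨e, ?_⟩
    rcases r with _ | r
    · exact Or.inl rfl
    · have := h' (r, j) (Prod.mk_lt_mk.2 (Or.inl ⟨Nat.lt_succ_self r, le_rfl⟩))
      rw [YoungDiagram.mem_iff_lt_rowLen] at this
      right
      simpa [e] using this
  · rintro ⟨rfl, h⟩
    refine ⟨by simp [YoungDiagram.mem_iff_lt_rowLen], ?_⟩
    rintro ⟨a, b⟩ hd
    rw [YoungDiagram.mem_iff_lt_rowLen]
    rcases Prod.mk_lt_mk.1 hd with ⟨h1, h2⟩ | ⟨h1, h2⟩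
    · have := μ.rowLen_anti a (r - 1) (by omega)
      omega
    · have := μ.rowLen_anti a r h1
      omega

theorem isRemovable_iff {μ : YoungDiagram} {r j : ℕ} :
    IsRemovable μ (r, j) ↔ j + 1 = μ.rowLen r ∧ μ.rowLen (r + 1) < μ.rowLen r := by
  constructor
  · rintro ⟨h, h'⟩
    have h1 := h' (r, j + 1) (Prod.mk_lt_mk.2 (Or.inr ⟨le_rfl, Nat.lt_succ_self j⟩))
    have h2 := h' (r + 1, j) (Prod.mk_lt_mk.2 (Or.inl ⟨Nat.lt_succ_self r, le_rfl⟩))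
    rw [YoungDiagram.mem_iff_lt_rowLen] at h h1 h2
    omega
  · rintro ⟨h, h'⟩
    refine ⟨by rw [YoungDiagram.mem_iff_lt_rowLen]; omega, ?_⟩
    rintro ⟨a, b⟩ hd
    rw [YoungDiagram.mem_iff_lt_rowLen]
    rcases Prod.mk_lt_mk.1 hd with ⟨h1, h2⟩ | ⟨h1, h2⟩
    · have := μ.rowLen_anti (r + 1) a (by omega)
      omega
    · have := μ.rowLen_anti r a h1
      omega

/-- The row lengths of `s_i μ`. -/
noncomputable def reflectRow (k : ℕ) (i : ZMod (k + 1)) (μ : YoungDiagram) (r : ℕ) : ℕ :=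
  open Classical in
  if ((μ.rowLen r : ZMod (k + 1)) - r = i) ∧ (r = 0 ∨ μ.rowLen r < μ.rowLen (r - 1)) then
    μ.rowLen r + 1
  else if ((μ.rowLen r : ZMod (k + 1)) - r = i + 1) ∧ μ.rowLen (r + 1) < μ.rowLen r then
    μ.rowLen r - 1
  else μ.rowLen r

theorem one_ne_zero_idx (k : ℕ) [NeZero k] : (1 : ZMod (k + 1)) ≠ 0 := by
  intro h
  have := (ZMod.natCast_eq_zero_iff 1 (k+1)).1 (by exact_mod_cast h)
  have := Nat.le_of_dvd one_pos this
  have := NeZero.ne k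
  omega

theorem mem_reflectCells {k : ℕ} [NeZero k] {i : ZMod (k + 1)} {μ : YoungDiagram} {r j : ℕ} :
    (r, j) ∈ reflectCells k i μ ↔ j < reflectRow k i μ r := by
  have h10 := one_ne_zero_idx k
  simp only [reflectCells, Set.mem_ofPred_eq, isAddable_iff, isRemovable_iff,
    YoungDiagram.mem_iff_lt_rowLen, content, reflectRow]
  have key : j + 1 = μ.rowLen r → (((j : ZMod (k + 1)) - r = i) ↔ ((μ.rowLen r : ZMod (k + 1)) - r = i + 1)) := by
    intro h
    rw [← h]; push_cast
    constructor <;> intro h <;> linear_combination h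
  have key2 : j = μ.rowLen r → (((j : ZMod (k + 1)) - r = i) ↔ ((μ.rowLen r : ZMod (k + 1)) - r = i)) := by
    rintro rfl; rfl
  have key3 : (μ.rowLen r : ZMod (k + 1)) - r = i → (μ.rowLen r : ZMod (k + 1)) - r = i + 1 → False := by
    intro a b
    exact h10 (by linear_combination a - b)
  split_ifs with h1 h2
  · by_cases hj : j + 1 = μ.rowLen r
    · have := key hj; constructor <;> intro <;> first | omega | (left; grind)
    · by_cases hj2 : j = μ.rowLen r <;> grind
  · by_cases hj : j + 1 = μ.rowLen r <;> grind
  · by_cases hj : j + 1 = μ.rowLen r <;> by_cases hj2 : j = μ.rowLen r <;> grind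

theorem reflectRow_anti {k : ℕ} [NeZero k] (i : ZMod (k + 1)) (μ : YoungDiagram) :
    Antitone (reflectRow k i μ) := by
  have h10 := one_ne_zero_idx k
  refine antitone_nat_of_succ_le fun r => ?_
  have h := μ.rowLen_anti r (r + 1) (Nat.le_succ r)
  have h3 : μ.rowLen (r + 1) < μ.rowLen r → μ.rowLen r - 1 < μ.rowLen (r + 1) + 1 → (μ.rowLen r : ZMod (k + 1)) - r = i + 1 →
      (μ.rowLen (r + 1) : ZMod (k + 1)) - (r + 1 : ℕ) = i → False := by
    intro h h' a b
    have h : μ.rowLen r = μ.rowLen (r + 1) + 1 := by omega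
    rw [h] at a
    push_cast at a b
    exact h10 (by linear_combination a - b)
  simp only [reflectRow, Nat.add_sub_cancel]
  split_ifs <;> first | omega | exact (by_contra fun hh => h3 (by omega) (by omega) (by tauto) (by tauto)) | grind

/-- `s_i μ` as a Young diagram. -/
noncomputable def boxReflect (k : ℕ) [NeZero k] (i : ZMod (k + 1)) (μ : YoungDiagram) : YoungDiagram where
  cells := Set.Finite.toFinset (s := reflectCells k i μ) <| by
    refine (((Finset.range (μ.colLen 0 + 1)) ×ˢ (Finset.range (μ.rowLen 0 + 1))).finite_toSet).subset ?_
    rintro ⟨r, j⟩ h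
    simp only [Finset.coe_product, Finset.coe_range, Set.mem_prod, Set.mem_Iio]
    have h0 := μ.rowLen_anti 0 r (Nat.zero_le r)
    rcases h with ⟨h, _⟩ | ⟨h, _⟩
    · have h1 := YoungDiagram.mem_iff_lt_rowLen.1 h
      have h2 := YoungDiagram.mem_iff_lt_colLen.1 (μ.up_left_mem le_rfl (Nat.zero_le j) h)
      omega
    · obtain ⟨rfl, h5⟩ := isAddable_iff.1 h
      refine ⟨?_, by omega⟩
      rcases h5 with rfl | h5
      · omega
      · have h2 := YoungDiagram.mem_iff_lt_colLen.1
          (YoungDiagram.mem_iff_lt_rowLen.2 (lt_of_le_of_lt (Nat.zero_le _) h5))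
        omega
  isLowerSet := by
    rintro ⟨r, j⟩ ⟨r', j'⟩ ⟨hr, hj⟩ h
    rw [Set.Finite.coe_toFinset, mem_reflectCells] at h ⊢
    have h1 := reflectRow_anti i μ hr
    simp only at hj h1
    omega

theorem mem_boxReflect {k : ℕ} [NeZero k] {i : ZMod (k + 1)} {μ : YoungDiagram} {b : ℕ × ℕ} :
    b ∈ boxReflect k i μ ↔ b ∈ reflectCells k i μ := by
  rw [← YoungDiagram.mem_cells]; simp [boxReflect]

theorem rowLen_boxReflect {k : ℕ} [NeZero k] (i : ZMod (k + 1)) (μ : YoungDiagram) (r : ℕ) :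
    (boxReflect k i μ).rowLen r = reflectRow k i μ r := by
  refine eq_of_forall_lt_iff fun j => ?_
  rw [← YoungDiagram.mem_iff_lt_rowLen, mem_boxReflect, mem_reflectCells]

/-- The set of the numbers `μ_r - r`, which determines `μ`. -/
def beads (μ : YoungDiagram) : Set ℤ := Set.range fun r : ℕ => (μ.rowLen r : ℤ) - r

theorem beads_injective : Function.Injective beads := by
  intro μ ν h
  have anti : ∀ μ : YoungDiagram, StrictMono fun r : ℕ => (r : ℤ) - μ.rowLen r := by
    intro μ
    refine strictMono_nat_of_lt_succ fun r => ?_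
    have := μ.rowLen_anti r (r + 1) (Nat.le_succ r)
    push_cast; omega
  have e : ∀ μ : YoungDiagram, Set.range (fun r : ℕ => (r : ℤ) - μ.rowLen r) = Neg.neg '' beads μ := by
    intro μ
    rw [beads, ← Set.range_comp]
    congr 1; funext r; simp
  have := ((anti μ).range_inj (anti ν)).1 (by rw [e, e, h])
  ext ⟨r, j⟩
  have hr := congrFun this r
  rw [YoungDiagram.mem_cells, YoungDiagram.mem_cells, YoungDiagram.mem_iff_lt_rowLen,
    YoungDiagram.mem_iff_lt_rowLen]
  omega

/-- The effect of `s_i` on the numbers `μ_r - r`. -/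
def beadSwap (k : ℕ) (i : ZMod (k + 1)) (m : ℤ) : ℤ :=
  if (m : ZMod (k + 1)) = i then m + 1 else if (m : ZMod (k + 1)) = i + 1 then m - 1 else m

theorem beadSwap_sq {k : ℕ} [NeZero k] (i : ZMod (k + 1)) (m : ℤ) :
    beadSwap k i (beadSwap k i m) = m := by
  have h10 := one_ne_zero_idx k
  have h11 : ∀ x : ZMod (k + 1), x + 1 ≠ x := fun x h => h10 (by linear_combination h)
  unfold beadSwap
  split_ifs <;> push_cast at * <;> grind

theorem succ_mem_beads {μ : YoungDiagram} {r : ℕ} :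
    ((μ.rowLen r : ℤ) - r + 1 ∈ beads μ) ↔ ¬ (r = 0 ∨ μ.rowLen r < μ.rowLen (r - 1)) := by
  constructor
  · rintro ⟨s, hs⟩ h
    simp only at hs
    rcases lt_or_ge s r with h1 | h1
    · have := μ.rowLen_anti s (r - 1) (by omega)
      omega
    · have := μ.rowLen_anti r s h1
      omega
  · intro h
    push Not at h
    refine ⟨r - 1, ?_⟩
    have := μ.rowLen_anti (r - 1) r (by omega)
    have := h.1
    simp only
    omega

theorem pred_mem_beads {μ : YoungDiagram} {r : ℕ} :
    ((μ.rowLen r : ℤ) - r - 1 ∈ beads μ) ↔ ¬ (μ.rowLen (r + 1) < μ.rowLen r) := by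
  constructor
  · rintro ⟨s, hs⟩ h
    simp only at hs
    rcases lt_or_ge r s with h1 | h1
    · have := μ.rowLen_anti (r + 1) s (by omega)
      omega
    · have := μ.rowLen_anti s r h1
      omega
  · intro h
    refine ⟨r + 1, ?_⟩
    have := μ.rowLen_anti r (r + 1) (by omega)
    simp only
    push_cast
    omega

theorem beads_boxReflect {k : ℕ} [NeZero k] (i : ZMod (k + 1)) (μ : YoungDiagram) :
    beads (boxReflect k i μ) = beadSwap k i '' beads μ := by
  classical
  have h10 := one_ne_zero_idx k
  have cast : ∀ r : ℕ, (((μ.rowLen r : ℤ) - r : ℤ) : ZMod (k + 1)) = (μ.rowLen r : ZMod (k + 1)) - r := by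
    intro r; push_cast; rfl
  -- the new bead of row `r`
  have row : ∀ r : ℕ, ((reflectRow k i μ r : ℤ) - r) =
      if (((μ.rowLen r : ℤ) - r : ℤ) : ZMod (k + 1)) = i ∧ (μ.rowLen r : ℤ) - r + 1 ∉ beads μ then
        (μ.rowLen r : ℤ) - r + 1
      else if (((μ.rowLen r : ℤ) - r : ℤ) : ZMod (k + 1)) = i + 1 ∧
          (μ.rowLen r : ℤ) - r - 1 ∉ beads μ then (μ.rowLen r : ℤ) - r - 1
      else (μ.rowLen r : ℤ) - r := by
    intro r
    simp only [succ_mem_beads, pred_mem_beads, not_not, cast, reflectRow]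
    split_ifs <;> push_cast <;> omega
  have row' : ∀ p ∈ beads μ, ∃ q ∈ beads (boxReflect k i μ), q =
      if ((p : ℤ) : ZMod (k + 1)) = i ∧ p + 1 ∉ beads μ then p + 1
      else if (p : ZMod (k + 1)) = i + 1 ∧ p - 1 ∉ beads μ then p - 1 else p := by
    rintro p ⟨r, rfl⟩
    exact ⟨_, ⟨r, rfl⟩, by simp only [rowLen_boxReflect]; exact row r⟩
  ext q
  constructor
  · rintro ⟨r, rfl⟩
    simp only [rowLen_boxReflect]
    rw [row r]
    have hp : (μ.rowLen r : ℤ) - r ∈ beads μ := ⟨r, rfl⟩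
    generalize (μ.rowLen r : ℤ) - r = p at hp ⊢
    refine ⟨beadSwap k i (if (p : ZMod (k + 1)) = i ∧ p + 1 ∉ beads μ then p + 1
      else if (p : ZMod (k + 1)) = i + 1 ∧ p - 1 ∉ beads μ then p - 1 else p), ?_, beadSwap_sq _ _⟩
    have h11 : ∀ x : ZMod (k + 1), x + 1 ≠ x := fun x h => h10 (by linear_combination h)
    unfold beadSwap
    split_ifs <;> push_cast at * <;> grind
  · rintro ⟨p, hp, rfl⟩
    obtain ⟨q, hq, e⟩ := row' p hp
    by_cases h1 : (p : ZMod (k + 1)) = i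
    · by_cases h2 : p + 1 ∈ beads μ
      · obtain ⟨q', hq', e'⟩ := row' _ h2
        have : ((p + 1 : ℤ) : ZMod (k + 1)) = i + 1 := by push_cast; rw [h1]
        have : beadSwap k i p = q' := by
          rw [e', beadSwap, if_pos h1, if_neg, if_neg]
          · simpa using fun _ => hp
          · rw [this]; intro h; exact h10 (by linear_combination h.1)
        rwa [this]
      · have : beadSwap k i p = q := by
          rw [e, beadSwap, if_pos h1, if_pos ⟨h1, h2⟩]
        rwa [this]
    · by_cases h3 : (p : ZMod (k + 1)) = i + 1
      · by_cases h2 : p - 1 ∈ beads μ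
        · obtain ⟨q', hq', e'⟩ := row' _ h2
          have : ((p - 1 : ℤ) : ZMod (k + 1)) = i := by push_cast; rw [h3]; ring
          have : beadSwap k i p = q' := by
            rw [e', beadSwap, if_neg h1, if_pos h3, if_neg, if_neg]
            · rw [this]; intro h; exact h10 (by linear_combination - h.1)
            · simpa using fun _ => hp
          rwa [this]
        · have : beadSwap k i p = q := by
            rw [e, beadSwap, if_neg h1, if_pos h3, if_neg (fun h => h1 h.1), if_pos ⟨h3, h2⟩]
          rwa [this]
      · have : beadSwap k i p = q := by
          rw [e, beadSwap, if_neg h1, if_neg h3, if_neg (fun h => h1 h.1), if_neg (fun h => h3 h.1)]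
        rwa [this]

/-- `μ ↦ s_i μ`, an involution. -/
noncomputable def boxReflectPerm (k : ℕ) [NeZero k] (i : ZMod (k + 1)) : Equiv.Perm YoungDiagram :=
  Function.Involutive.toPerm (boxReflect k i) fun μ => beads_injective <| by
    rw [beads_boxReflect, beads_boxReflect, ← Set.image_comp]
    convert Set.image_id _
    funext m; exact beadSwap_sq i m

theorem boxReflectPerm_comm {k : ℕ} [NeZero k] (i j : ZMod (k + 1)) (h : i - j ≠ 1) (h' : j - i ≠ 1) :
    boxReflectPerm k i * boxReflectPerm k j = boxReflectPerm k j * boxReflectPerm k i := by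
  ext1 μ
  change boxReflect k i (boxReflect k j μ) = boxReflect k j (boxReflect k i μ)
  apply beads_injective
  simp only [beads_boxReflect, ← Set.image_comp]
  congr 1; funext m
  simp only [Function.comp, beadSwap]
  split_ifs <;> push_cast at * <;> grind

theorem boxReflectPerm_braid {k : ℕ} [NeZero k] (hk : 2 ≤ k) (i : ZMod (k + 1)) :
    boxReflectPerm k i * boxReflectPerm k (i + 1) * boxReflectPerm k i =
      boxReflectPerm k (i + 1) * boxReflectPerm k i * boxReflectPerm k (i + 1) := by
  ext1 μ
  change boxReflect k i (boxReflect k (i + 1) (boxReflect k i μ)) =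
    boxReflect k (i + 1) (boxReflect k i (boxReflect k (i + 1) μ))
  apply beads_injective
  simp only [beads_boxReflect, ← Set.image_comp]
  congr 1; funext m
  obtain ⟨h0, h1⟩ := one_ne hk
  have e1 : i + 1 ≠ i := fun h => h0 (by linear_combination h)
  have e2 : i + 1 + 1 ≠ i := fun h => h1 (by linear_combination h)
  have e3 : i + 1 + 1 ≠ i + 1 := fun h => h0 (by linear_combination h)
  simp only [Function.comp, beadSwap]
  by_cases a : (m : ZMod (k + 1)) = i
  · simp [a, e2, e3, e1.symm, e2.symm]
  · by_cases b : (m : ZMod (k + 1)) = i + 1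
    · simp [b, e1, e2, e3, e1.symm, e2.symm]
    · by_cases c : (m : ZMod (k + 1)) = i + 1 + 1
      · simp [c, e1, e2, e3, e1.symm, e2.symm]
      · simp [a, b, c]

/-- The action of `W` on Young diagrams, in particular on `(k+1)`-cores. -/
noncomputable def boxAct (k : ℕ) [NeZero k] : AffineWeyl k →* Equiv.Perm YoungDiagram :=
  (coxSys k).lift ⟨boxReflectPerm k, isLiftable _
    (fun i => Equiv.ext fun μ => (boxReflectPerm k i).left_inv μ)
    boxReflectPerm_comm boxReflectPerm_braid⟩

/-- `w ∈ W^0` and `w ∅ = ν`. -/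
def IsCoreRep (k : ℕ) [NeZero k] (ν : YoungDiagram) (w : AffineWeyl k) : Prop :=
  w ∈ minReps k ∧ boxAct k w ⊥ = ν

/-- `w_ν`: the element of `W^0` with `w_ν ∅ = ν`. -/
noncomputable def coreRep (k : ℕ) [NeZero k] (ν : YoungDiagram) : AffineWeyl k :=
  Classical.epsilon (IsCoreRep k ν)

/-- The rectangle `(c^r)` with `r` rows and `c` columns. -/
def rect (c r : ℕ) : YoungDiagram where
  cells := Finset.range r ×ˢ Finset.range c
  isLowerSet := by
    rintro ⟨i, j⟩ ⟨i', j'⟩ ⟨hi, hj⟩ h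
    simp only [Finset.coe_product, Finset.coe_range, Set.mem_prod, Set.mem_Iio] at h hi hj ⊢
    omega

/-- The partitions contained in `(c^r)`. -/
def partsIn (c r : ℕ) : Set YoungDiagram := {ν | ν ≤ rect c r}

theorem finite_partsIn (c r : ℕ) : (partsIn c r).Finite := by
  refine Set.Finite.of_finite_image (f := YoungDiagram.cells)
    ((Finset.finite_toSet (rect c r).cells.powerset).subset ?_) ?_
  · rintro _ ⟨ν, h, rfl⟩
    exact Finset.mem_coe.2 (Finset.mem_powerset.2 (YoungDiagram.cells_subset_iff.2 h))
  · intro μ _ ν _ h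
    exact YoungDiagram.ext h

/-- `(R, ν)`: the partition whose rows are `r` rows of length `c` followed by the rows of `ν`. It is
used for `ν` contained in `R = (c^r)`, where the condition `b.2 < c` on the cells of `ν` is void. -/
def stack (c r : ℕ) (ν : YoungDiagram) : YoungDiagram where
  cells := (Finset.range r ×ˢ Finset.range c) ∪
    (ν.cells.filter fun b => b.2 < c).image fun b => (b.1 + r, b.2)
  isLowerSet := by
    rintro ⟨i, j⟩ ⟨i', j'⟩ ⟨hi, hj⟩ h
    simp only [Finset.coe_union, Finset.coe_product, Finset.coe_range, Finset.coe_image,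
      Finset.coe_filter, Set.mem_union, Set.mem_prod, Set.mem_Iio, Set.mem_image,
      Set.mem_ofPred_eq, Prod.exists, Prod.mk.injEq, YoungDiagram.mem_cells] at h hi hj ⊢
    rcases h with h | ⟨a, b, ⟨hab, hb⟩, rfl, rfl⟩
    · left; omega
    · by_cases h' : i' < r
      · left; omega
      · right
        exact ⟨i' - r, j', ⟨ν.up_left_mem (by omega) hj hab, by omega⟩, by omega, rfl⟩

/-- The word of contents of the cells of the skew shape `κ/μ`: the rows are read starting with the
top row, that is, the shortest and last one (diagrams are drawn with the longest row at the bottom),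
and each row is read from right to left. -/
def skewWord (k : ℕ) (κ μ : YoungDiagram) : List (ZMod (k + 1)) :=
  (List.range (κ.colLen 0)).reverse.flatMap fun i =>
    ((List.range (κ.rowLen i)).reverse.filter fun j => μ.rowLen i ≤ j).map fun j => content k (i, j)

/-- `V_{κ/μ} ∈ W`: the product of the generators along the reading word of `κ/μ`. -/
def readElt (k : ℕ) (κ μ : YoungDiagram) : AffineWeyl k := (coxSys k).wordProd (skewWord k κ μ)

/-! The affine nilCoxeter algebra. -/

/-- The defining relations of the affine nilCoxeter algebra; for `k = 1` there is no braid
relation. -/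
inductive NilRel (K : Type*) [CommRing K] (k : ℕ) :
    FreeAlgebra K (ZMod (k + 1)) → FreeAlgebra K (ZMod (k + 1)) → Prop
  | sq (i : ZMod (k + 1)) : NilRel K k (FreeAlgebra.ι K i * FreeAlgebra.ι K i) 0
  | comm (i j : ZMod (k + 1)) (h : i - j ≠ 1) (h' : j - i ≠ 1) :
      NilRel K k (FreeAlgebra.ι K i * FreeAlgebra.ι K j) (FreeAlgebra.ι K j * FreeAlgebra.ι K i)
  | braid (hk : 2 ≤ k) (i : ZMod (k + 1)) :
      NilRel K k (FreeAlgebra.ι K i * FreeAlgebra.ι K (i + 1) * FreeAlgebra.ι K i)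
        (FreeAlgebra.ι K (i + 1) * FreeAlgebra.ι K i * FreeAlgebra.ι K (i + 1))

/-- The affine nilCoxeter algebra over the commutative ring `K`. -/
abbrev NilCoxeter (K : Type*) [CommRing K] (k : ℕ) : Type _ := RingQuot (NilRel K k)

/-- The generator `u_i`. -/
noncomputable def nilGen (K : Type*) [CommRing K] (k : ℕ) (i : ZMod (k + 1)) : NilCoxeter K k :=
  RingQuot.mkAlgHom K (NilRel K k) (FreeAlgebra.ι K i)

/-- A reduced word of `w`. -/
noncomputable def redWord (k : ℕ) (w : AffineWeyl k) : List (ZMod (k + 1)) :=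
  ((coxSys k).exists_isReduced w).choose

theorem redWord_spec (k : ℕ) (w : AffineWeyl k) :
    (coxSys k).IsReduced (redWord k w) ∧ w = (coxSys k).wordProd (redWord k w) :=
  ((coxSys k).exists_isReduced w).choose_spec

/-- `u(w)`: the product of the generators `u_i` along a reduced word of `w`. Reduced words of `w`
are connected by commutation and braid moves, which hold in the algebra, so the product does not
depend on the reduced word. -/
noncomputable def nilBasis (K : Type*) [CommRing K] (k : ℕ) (w : AffineWeyl k) : NilCoxeter K k :=
  ((redWord k w).map (nilGen K k)).prod

/-- `X_R`, the sum of `u(V_{(R,ν)/ν})` over the partitions `ν` contained in `R = (c^r)`. -/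
noncomputable def XR (K : Type*) [CommRing K] (k c r : ℕ) : NilCoxeter K k :=
  ∑ ν ∈ (finite_partsIn c r).toFinset, nilBasis K k (readElt k (stack c r ν) ν)

/-- `Y_R`, the sum of `u(z_γ)` over `γ ∈ Γ`. -/
noncomputable def YR (K : Type*) [CommRing K] (k c : ℕ) : NilCoxeter K k :=
  ∑ γ ∈ (finite_Gam k c).toFinset, nilBasis K k (pseudoTrans k γ)

/-- `ψ(ν) = w_ν ⋆ Λ_c`. -/
noncomputable def psi (k c : ℕ) [NeZero k] (ν : YoungDiagram) : VSpace k :=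
  starAct k (coreRep k ν) (fundWeight k c)

end AffineA

open AffineA

/-!
The affine symmetric group `W` is realized by affine permutations of `ℤ`: the generator `s_i`
exchanges `m` and `m + 1` for every `m ≡ i` modulo `k + 1`, and `w` acts by `affPerm k w`. All the
objects in the theorem are read off from `affPerm`.

* The realization is faithful, and it knows descents (`affPerm_lt_of_not_isRightDescent`): this is
  Tits's argument, by induction on length, with a case distinction on the order of `s_i s_j`. Hence an
  element is trivial once its affine permutation is increasing (`eq_one_of_strictMono`).
* The beads `μ_r - r` of a Young diagram are permuted by `affPerm` (`beads_boxAct`). The empty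
  diagram has the nonpositive integers as its beads, and the elements of `W^0` are those whose affine
  permutation is increasing on `1, …, k + 1`; so the diagram `w ∅` determines `w ∈ W^0`.
* A vector of `V` extends to a function on `ℤ` with `a_{m+k+1} = a_m - 1`, the action `⋄` permutes
  the indices of the extension, and the fundamental alcove is the set of decreasing extensions.
  Translating by an integral vector `g` replaces the index `m` by `m - (k + 1) g_m`. So
  `y = z_γ` as soon as `affPerm k y m = m + c - (k + 1) γ_m`
  (`isPseudoTranslation_of_affPerm`), and distinct elements have distinct alcoves.
* In the window `(-r, c]` of `k + 1` consecutive integers a row of a skew shape acts as a cycle, which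
  moves one bead to the right and keeps the order of all other integers. Therefore the reading word of
  `κ/μ`, with `μ ⊆ κ ⊆ R`, moves the beads of `μ` to those of `κ` and keeps the order of the others
  (`affPerm_rowsWord`). In particular the reading word of `ν` is a word of `w_ν`, and followed by that
  of `R/ν` it gives `w_R`, the permutation `x ↦ x + c - (k + 1) Λ_c(x)`. The rest of `(R, ν)/ν` is a
  copy of `ν` with contents rotated by `c`. So with `τ(m) = m + c` the affine permutation of
  `V_{(R,ν)/ν}` is `τ w_ν τ⁻¹ w_R w_ν⁻¹`, that is `m ↦ m + c - (k + 1) Λ_c(w_ν⁻¹ m)`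
  (`affPerm_readElt_stack`), which is the affine permutation of `z_{ψ(ν)}`.
* On the window, the 0/1 vector `ψ(ν) = w_ν ⋆ Λ_c` vanishes exactly at the beads of `ν`. The `r`
  beads in the window form an arbitrary `r`-subset and determine `ν`, so `ψ` is a bijection.

The identity `X_R = Y_R` is then a reindexing of the sum.
-/

namespace AffineA

/-! ### Affine permutations of the integers -/

theorem intCast_eq_intCast_iff {k : ℕ} {a b : ℤ} :
    (a : ZMod (k + 1)) = b ↔ ((k : ℤ) + 1) ∣ b - a := by
  rw [ZMod.intCast_eq_intCast_iff_dvd_sub]; push_cast; rfl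

theorem beadSwap_of_eq {k : ℕ} {i : ZMod (k + 1)} {m : ℤ} (h : (m : ZMod (k + 1)) = i) :
    beadSwap k i m = m + 1 := by simp [beadSwap, h]

theorem beadSwap_of_eq_add_one {k : ℕ} [NeZero k] {i : ZMod (k + 1)} {m : ℤ}
    (h : (m : ZMod (k + 1)) = i + 1) : beadSwap k i m = m - 1 := by
  have h10 := one_ne_zero_idx k
  rw [beadSwap, if_neg (fun h' => h10 (by linear_combination h' - h)), if_pos h]

theorem beadSwap_of_ne {k : ℕ} {i : ZMod (k + 1)} {m : ℤ} (h : (m : ZMod (k + 1)) ≠ i)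
    (h' : (m : ZMod (k + 1)) ≠ i + 1) : beadSwap k i m = m := by
  rw [beadSwap, if_neg h, if_neg h']

/-- The permutation of `ℤ` exchanging `m` and `m + 1` for every `m ≡ i`. -/
def beadPerm (k : ℕ) [NeZero k] (i : ZMod (k + 1)) : Equiv.Perm ℤ :=
  Function.Involutive.toPerm (beadSwap k i) (beadSwap_sq i)

theorem beadPerm_comm {k : ℕ} [NeZero k] (i j : ZMod (k + 1)) (h : i - j ≠ 1) (h' : j - i ≠ 1) :
    beadPerm k i * beadPerm k j = beadPerm k j * beadPerm k i := by
  ext1 m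
  change beadSwap k i (beadSwap k j m) = beadSwap k j (beadSwap k i m)
  simp only [beadSwap]
  split_ifs <;> push_cast at * <;> grind

theorem beadPerm_braid {k : ℕ} [NeZero k] (hk : 2 ≤ k) (i : ZMod (k + 1)) :
    beadPerm k i * beadPerm k (i + 1) * beadPerm k i =
      beadPerm k (i + 1) * beadPerm k i * beadPerm k (i + 1) := by
  ext1 m
  change beadSwap k i (beadSwap k (i + 1) (beadSwap k i m)) =
    beadSwap k (i + 1) (beadSwap k i (beadSwap k (i + 1) m))
  obtain ⟨h0, h1⟩ := one_ne hk
  have e1 : i + 1 ≠ i := fun h => h0 (by linear_combination h)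
  have e2 : i + 1 + 1 ≠ i := fun h => h1 (by linear_combination h)
  have e3 : i + 1 + 1 ≠ i + 1 := fun h => h0 (by linear_combination h)
  simp only [beadSwap]
  by_cases a : (m : ZMod (k + 1)) = i
  · simp [a, e2, e3, e1.symm, e2.symm]
  · by_cases b : (m : ZMod (k + 1)) = i + 1
    · simp [b, e1, e2, e3, e1.symm, e2.symm]
    · by_cases c : (m : ZMod (k + 1)) = i + 1 + 1
      · simp [c, e1, e2, e3, e1.symm, e2.symm]
      · simp [a, b, c]

/-- The realization of `W` by affine permutations of `ℤ`. -/
def affPerm (k : ℕ) [NeZero k] : AffineWeyl k →* Equiv.Perm ℤ :=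
  (coxSys k).lift ⟨beadPerm k, isLiftable _ (fun i => Equiv.ext fun m => beadSwap_sq i m)
    beadPerm_comm beadPerm_braid⟩

variable {k : ℕ} [NeZero k]

theorem affPerm_simple (i : ZMod (k + 1)) (m : ℤ) :
    affPerm k ((coxSys k).simple i) m = beadSwap k i m := by
  rw [affPerm, CoxeterSystem.lift_apply_simple]; rfl

theorem affPerm_simple_inv (i : ZMod (k + 1)) (m : ℤ) :
    (affPerm k ((coxSys k).simple i))⁻¹ m = beadSwap k i m := by
  rw [← map_inv, CoxeterSystem.inv_simple, affPerm_simple]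

theorem affPerm_mul_simple (w : AffineWeyl k) (i : ZMod (k + 1)) (m : ℤ) :
    affPerm k (w * (coxSys k).simple i) m = affPerm k w (beadSwap k i m) := by
  rw [map_mul, Equiv.Perm.mul_apply, affPerm_simple]

omit [NeZero k] in
theorem beadSwap_add_period (i : ZMod (k + 1)) (m t : ℤ) :
    beadSwap k i (m + (k + 1) * t) = beadSwap k i m + (k + 1) * t := by
  have : ((m + (k + 1) * t : ℤ) : ZMod (k + 1)) = m := by
    have : ((k : ZMod (k + 1)) + 1) = 0 := by exact_mod_cast ZMod.natCast_self (k + 1)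
    push_cast; rw [this]; ring
  simp only [beadSwap, this]
  split_ifs <;> ring

theorem affPerm_add_period (w : AffineWeyl k) (m t : ℤ) :
    affPerm k w (m + (k + 1) * t) = affPerm k w m + (k + 1) * t := by
  induction w using (coxSys k).simple_induction_left with
  | one => simp
  | mul_simple_left w i ih =>
    rw [map_mul, Equiv.Perm.mul_apply, Equiv.Perm.mul_apply, ih, affPerm_simple, affPerm_simple,
      beadSwap_add_period]

omit [NeZero k] in
theorem simple_comm {i j : ZMod (k + 1)} (h : i - j ≠ 1) (h' : j - i ≠ 1) :
    (coxSys k).simple i * (coxSys k).simple j = (coxSys k).simple j * (coxSys k).simple i := by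
  by_cases hij : i = j
  · rw [hij]
  have := (coxSys k).simple_mul_simple_pow i j
  have e : (coxeterMatrix k).M i j = 2 := by
    change (if i = j then 1 else if i - j = 1 ∨ j - i = 1 then (if k = 1 then 0 else 3) else 2) = 2
    simp [hij, h, h']
  rw [e, pow_two, mul_eq_one_iff_eq_inv] at this
  simpa using this

omit [NeZero k] in
theorem simple_braid {i j : ZMod (k + 1)} (hk : 2 ≤ k) (h : i - j = 1 ∨ j - i = 1) :
    (coxSys k).simple i * (coxSys k).simple j * (coxSys k).simple i =
      (coxSys k).simple j * (coxSys k).simple i * (coxSys k).simple j := by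
  have hij : i ≠ j := by
    rintro rfl
    rw [sub_self, or_self] at h
    exact (one_ne hk).1 h.symm
  have := (coxSys k).simple_mul_simple_pow i j
  have e : (coxeterMatrix k).M i j = 3 := by
    change (if i = j then 1 else if i - j = 1 ∨ j - i = 1 then (if k = 1 then 0 else 3) else 2) = 3
    rw [if_neg hij, if_pos h, if_neg (by omega)]
  rw [e, show ∀ a b : AffineWeyl k, (a * b) ^ 3 = (a * b * a) * (b * a * b) by
    intro a b; simp only [pow_succ, pow_zero, one_mul, mul_assoc], mul_eq_one_iff_eq_inv] at this
  simpa [mul_assoc] using this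

/-- The sign of the root `w(α_i)` detects descents: if `w s_i` is longer than `w`, then the affine
permutation of `w` is increasing at `i`. The induction removes a descent `j ≠ i` of `w` and
distinguishes the order of `s_i s_j`. -/
theorem affPerm_lt_of_not_isRightDescent (w : AffineWeyl k) {m : ℤ}
    (h : ¬ (coxSys k).IsRightDescent w (m : ZMod (k + 1))) :
    affPerm k w m < affPerm k w (m + 1) := by
  have h10 := one_ne_zero_idx k
  have h11 : ∀ x : ZMod (k + 1), x + 1 ≠ x := fun x h => h10 (by linear_combination h)
  induction hl : (coxSys k).length w using Nat.strong_induction_on generalizing w m with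
  | _ l ih =>
  by_cases hw : w = 1
  · simp [hw]
  obtain ⟨j, hj⟩ := (coxSys k).exists_rightDescent_of_ne_one hw
  have hij : j ≠ m := fun e => h (e ▸ hj)
  obtain ⟨w', rfl⟩ : ∃ w', w = w' * (coxSys k).simple j := ⟨w * (coxSys k).simple j, by simp⟩
  have hw' : (coxSys k).length (w' * (coxSys k).simple j) = (coxSys k).length w' + 1 := by
    have := (coxSys k).isRightDescent_iff.1 hj
    rw [(coxSys k).simple_mul_simple_cancel_right] at this
    exact this.symm
  have hj' : ¬ (coxSys k).IsRightDescent w' j := by rw [(coxSys k).not_isRightDescent_iff]; exact hw'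
  have hlen := (coxSys k).not_isRightDescent_iff.1 h
  have ih' : ∀ q : ℤ, ¬ (coxSys k).IsRightDescent w' (q : ZMod (k + 1)) →
      affPerm k w' q < affPerm k w' (q + 1) := fun q hq => ih _ (by omega) w' hq rfl
  -- if `i` is a descent of `w s_j`, a second factor `s_i` is removed
  have desc : (coxSys k).IsRightDescent w' (m : ZMod (k + 1)) → ∃ w'',
      w' = w'' * (coxSys k).simple m ∧ (coxSys k).length w' = (coxSys k).length w'' + 1 := by
    intro hd
    exact ⟨w' * (coxSys k).simple m, by simp, ((coxSys k).isRightDescent_iff.1 hd).symm⟩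
  have desc2 : ∀ w'', 2 ≤ k → ((m : ZMod (k + 1)) - j = 1 ∨ j - (m : ZMod (k + 1)) = 1) →
      w' = w'' * (coxSys k).simple m → (coxSys k).length w' = (coxSys k).length w'' + 1 →
      ¬ (coxSys k).IsRightDescent w'' j := by
    intro w'' hk hjm e hl'' hd
    have h1 := (coxSys k).isRightDescent_iff.1 hd
    have h2 : w' * (coxSys k).simple j * (coxSys k).simple m =
        w'' * (coxSys k).simple j * (coxSys k).simple m * (coxSys k).simple j := by
      have := simple_braid hk hjm
      simp only [mul_assoc] at this
      rw [e]; simp only [mul_assoc, this]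
    have h3 := (coxSys k).length_mul_le (w'' * (coxSys k).simple j * (coxSys k).simple m)
      ((coxSys k).simple j)
    have h4 := (coxSys k).length_mul_le (w'' * (coxSys k).simple j) ((coxSys k).simple m)
    rw [(coxSys k).length_simple] at h3 h4
    rw [h2] at hlen
    omega
  simp only [affPerm_mul_simple]
  by_cases h1 : j = m + 1
  · have hA := ih' (m + 1) (by push_cast; rwa [← h1])
    rw [beadSwap_of_eq (by push_cast; exact h1.symm : ((m + 1 : ℤ) : ZMod (k + 1)) = j)]
    by_cases h2 : (m : ZMod (k + 1)) = j + 1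
    · -- both neighbours of `i` coincide, and `w(α_i) = δ + w'(α_j)`
      have hk : k = 1 := by
        have h20 : ((2 : ℕ) : ZMod (k + 1)) = 0 := by
          push_cast; linear_combination - h1 - h2
        have := Nat.le_of_dvd two_pos ((ZMod.natCast_eq_zero_iff 2 (k + 1)).1 h20)
        have := NeZero.ne k
        omega
      have h3 := affPerm_add_period w' (m - 1) 1
      rw [show m - 1 + ((k : ℤ) + 1) * 1 = m + 1 by rw [hk]; ring] at h3
      rw [beadSwap_of_eq_add_one h2]
      omega
    · have hk : 2 ≤ k := by
        by_contra hk
        have hk1 : k = 1 := by have := NeZero.ne k; omega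
        subst hk1
        exact h2 (by rw [h1, add_assoc]; exact (add_zero _).symm)
      rw [beadSwap_of_ne (Ne.symm hij) h2]
      by_cases hd : (coxSys k).IsRightDescent w' (m : ZMod (k + 1))
      · obtain ⟨w'', e, hl''⟩ := desc hd
        have h5 := desc2 w'' hk (Or.inr (by rw [h1]; ring)) e hl''
        have h6 : affPerm k w'' (m + 1) < affPerm k w'' (m + 1 + 1) :=
          ih _ (by omega) w'' (by push_cast; rwa [← h1]) rfl
        rw [e, affPerm_mul_simple, affPerm_mul_simple, beadSwap_of_eq rfl, beadSwap_of_ne]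
        · exact h6
        · push_cast; rw [← h1]; exact Ne.symm h2
        · push_cast; exact h11 _
      · exact (ih' m hd).trans hA
  · by_cases h2 : (m : ZMod (k + 1)) = j + 1
    · have hk : 2 ≤ k := by
        by_contra hk
        have hk1 : k = 1 := by have := NeZero.ne k; omega
        subst hk1
        exact h1 (by rw [h2, add_assoc]; exact (add_zero _).symm)
      have hm1 : ((m - 1 : ℤ) : ZMod (k + 1)) = j := by push_cast; rw [h2]; ring
      have hA := ih' (m - 1) (by rwa [hm1])
      rw [sub_add_cancel] at hA
      rw [beadSwap_of_eq_add_one h2, beadSwap_of_ne (m := m + 1) (by push_cast; exact Ne.symm h1)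
        (by push_cast; rw [← h2]; exact h11 _)]
      by_cases hd : (coxSys k).IsRightDescent w' (m : ZMod (k + 1))
      · obtain ⟨w'', e, hl''⟩ := desc hd
        have h5 := desc2 w'' hk (Or.inl (by rw [h2]; ring)) e hl''
        have h6 : affPerm k w'' (m - 1) < affPerm k w'' (m - 1 + 1) :=
          ih _ (by omega) w'' (by rwa [hm1]) rfl
        rw [e, affPerm_mul_simple, affPerm_mul_simple,
          beadSwap_of_ne (m := m - 1) (by rwa [hm1]) (by rwa [hm1]),
          beadSwap_of_eq_add_one (m := m + 1) (by push_cast; rfl)]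
        simpa using h6
      · exact hA.trans (ih' m hd)
    · rw [beadSwap_of_ne (Ne.symm hij) h2, beadSwap_of_ne (by push_cast; exact Ne.symm h1)
        (by push_cast; intro e; exact hij (by linear_combination - e))]
      refine ih' m fun hd => ?_
      obtain ⟨w'', e, hl''⟩ := desc hd
      have hc := simple_comm (i := (m : ZMod (k + 1))) (j := j)
        (fun e => h2 (by linear_combination e)) (fun e => h1 (by linear_combination e))
      have h4 := (coxSys k).length_mul_le w'' ((coxSys k).simple j)
      rw [(coxSys k).length_simple] at h4
      rw [e, mul_assoc w'', hc, ← mul_assoc, (coxSys k).simple_mul_simple_cancel_right] at hlen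
      rw [e, mul_assoc w'', hc] at hw'
      rw [e] at hl''
      simp only [← mul_assoc] at hw'
      omega

/-- An element of `W` whose affine permutation is strictly increasing is trivial; in particular
`affPerm` is injective. -/
theorem eq_one_of_strictMono {w : AffineWeyl k} (h : StrictMono (affPerm k w)) : w = 1 := by
  by_contra hw
  obtain ⟨j, hj⟩ := (coxSys k).exists_rightDescent_of_ne_one hw
  obtain ⟨m, rfl⟩ := ZMod.intCast_surjective j
  have h1 := affPerm_lt_of_not_isRightDescent (w * (coxSys k).simple m) (m := m)
    ((coxSys k).isRightDescent_iff_not_isRightDescent_mul.1 hj)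
  rw [affPerm_mul_simple, affPerm_mul_simple, beadSwap_of_eq rfl,
    beadSwap_of_eq_add_one (m := m + 1) (by push_cast; rfl), add_sub_cancel_right] at h1
  exact absurd (h (lt_add_one m)) h1.not_gt

/-! ### Elements of minimal length and Young diagrams -/

/-- A strictly increasing function from an interval of integers to an interval of the same length
is the translation. -/
theorem eq_add_of_strictMonoOn {f : ℤ → ℤ} {a b d : ℤ} (hf : ∀ x y, a < x → x < y → y ≤ b → f x < f y)
    (hm : ∀ x, a < x → x ≤ b → a + d < f x ∧ f x ≤ b + d) {x : ℤ} (h1 : a < x) (h2 : x ≤ b) :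
    f x = x + d := by
  have low : ∀ y, a + 1 ≤ y → y ≤ b → y + d ≤ f y := by
    intro y hy
    induction y, hy using Int.leInduction with
    | base => intro h; have := (hm (a + 1) (by omega) h).1; omega
    | succ y hy ih =>
      intro h
      have := ih (by omega)
      have := hf y (y + 1) (by omega) (by omega) h
      omega
  have up : ∀ y, y ≤ b → a < y → f y ≤ y + d := by
    intro y hy
    induction y, hy using Int.leInductionDown with
    | base => intro h; have := (hm b h le_rfl).2; omega
    | pred y hy ih =>
      intro h
      have := ih (by omega)
      have := hf (y - 1) y (by omega) (by omega) hy
      omega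
  exact le_antisymm (up x h2 h1) (low x h1 h2)

omit [NeZero k] in
theorem exists_eq_add_period (L x : ℤ) :
    ∃ y t, L < y ∧ y ≤ L + (k + 1) ∧ x = y + ((k : ℤ) + 1) * t := by
  have hk : (0 : ℤ) < k + 1 := by omega
  have h1 := Int.emod_add_mul_ediv (x - 1 - L) (k + 1)
  have h2 := Int.emod_nonneg (x - 1 - L) hk.ne'
  have h3 := Int.emod_lt_of_pos (x - 1 - L) hk
  exact ⟨(x - 1 - L) % (k + 1) + 1 + L, (x - 1 - L) / (k + 1), by omega, by omega, by omega⟩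

theorem beads_boxAct (w : AffineWeyl k) (μ : YoungDiagram) :
    beads (boxAct k w μ) = affPerm k w '' beads μ := by
  induction w using (coxSys k).simple_induction_left with
  | one => simp
  | mul_simple_left w i ih =>
    rw [map_mul, Equiv.Perm.mul_apply, map_mul, Equiv.Perm.coe_mul, Set.image_comp, ← ih]
    have e : boxAct k ((coxSys k).simple i) = boxReflectPerm k i := by
      rw [boxAct, CoxeterSystem.lift_apply_simple]
    rw [e]
    exact (beads_boxReflect i _).trans (Set.image_congr fun m _ => (affPerm_simple i m).symm)

theorem rowLen_bot (i : ℕ) : (⊥ : YoungDiagram).rowLen i = 0 := by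
  by_contra h
  exact YoungDiagram.notMem_bot _ (YoungDiagram.mem_iff_lt_rowLen.2 (Nat.pos_of_ne_zero h))

theorem beads_bot : beads ⊥ = Set.Iic 0 := by
  ext m
  simp only [beads, rowLen_bot, Set.mem_range, Set.mem_Iic]
  exact ⟨fun ⟨r, hr⟩ => by push_cast at hr; omega, fun h => ⟨(-m).toNat, by push_cast; omega⟩⟩

/-- An affine permutation that is increasing on `1, …, k + 1` is determined by the image of the
nonpositive integers. -/
theorem eq_of_image_Iic_eq {w w' : AffineWeyl k}
    (h : ∀ x y, 0 < x → x < y → y ≤ (k : ℤ) + 1 → affPerm k w x < affPerm k w y)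
    (h' : ∀ x y, 0 < x → x < y → y ≤ (k : ℤ) + 1 → affPerm k w' x < affPerm k w' y)
    (e : affPerm k w '' Set.Iic 0 = affPerm k w' '' Set.Iic 0) : w = w' := by
  set σ := affPerm k (w⁻¹ * w') with hσ
  have hww : ∀ x, affPerm k w (σ x) = affPerm k w' x := by
    intro x
    rw [hσ, ← Equiv.Perm.mul_apply, ← map_mul, mul_inv_cancel_left]
  have h0 : ∀ x, σ x ≤ 0 ↔ x ≤ 0 := by
    intro x
    have : affPerm k w (σ x) ∈ affPerm k w '' Set.Iic 0 ↔ affPerm k w' x ∈ affPerm k w' '' Set.Iic 0 := by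
      rw [e, hww]
    simpa using this
  have hn : ∀ x, σ x ≤ (k : ℤ) + 1 ↔ x ≤ (k : ℤ) + 1 := by
    intro x
    have := affPerm_add_period (w⁻¹ * w') x (-1)
    rw [← hσ] at this
    have h2 := h0 (x + (k + 1) * (-1))
    rw [this] at h2
    constructor <;> intro <;> [have := h2.1; have := h2.2] <;> omega
  have hmem : ∀ x, 0 < x → x ≤ (k : ℤ) + 1 → 0 < σ x ∧ σ x ≤ (k : ℤ) + 1 := fun x h1 h2 =>
    ⟨not_le.1 fun h3 => absurd ((h0 x).1 h3) (by omega), (hn x).2 h2⟩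
  have hmono : ∀ x y, 0 < x → x < y → y ≤ (k : ℤ) + 1 → σ x < σ y := by
    intro x y hx hxy hy
    by_contra hc
    rcases eq_or_lt_of_le (not_lt.1 hc) with h3 | h3
    · exact hxy.ne (σ.injective h3).symm
    · have h4 := h _ _ (hmem y (by omega) hy).1 h3 (hmem x hx (by omega)).2
      rw [hww, hww] at h4
      exact absurd (h' x y hx hxy hy) h4.not_gt
  have hid : ∀ x, 0 < x → x ≤ (k : ℤ) + 1 → σ x = x := fun x h1 h2 => by
    simpa using eq_add_of_strictMonoOn (d := 0) hmono (by simpa using hmem) h1 h2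
  have hall : ∀ x, σ x = x := by
    intro x
    obtain ⟨y, t, h1, h2, rfl⟩ := exists_eq_add_period (k := k) 0 x
    rw [hσ, affPerm_add_period, ← hσ, hid y h1 (by omega)]
  have : w⁻¹ * w' = 1 := eq_one_of_strictMono (by rw [← hσ]; intro x y h; rwa [hall, hall])
  exact inv_mul_eq_one.1 this

/-- Elements of `W^0` are increasing on `1, …, k + 1`. -/
theorem affPerm_lt_of_mem_minReps {w : AffineWeyl k} (hw : w ∈ minReps k) (x y : ℤ) (hx : 0 < x)
    (hxy : x < y) (hy : y ≤ (k : ℤ) + 1) : affPerm k w x < affPerm k w y := by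
  induction y, (show x + 1 ≤ y from hxy) using Int.leInduction with
  | base =>
    refine affPerm_lt_of_not_isRightDescent w ?_
    rw [CoxeterSystem.IsRightDescent, not_lt]
    refine hw _ (Subgroup.subset_closure ⟨_, ?_, rfl⟩)
    intro h0
    obtain ⟨t, ht⟩ := intCast_eq_intCast_iff.1 (h0.trans Int.cast_zero.symm)
    have : 0 < x := hx
    have : x < (k : ℤ) + 1 := hy
    rcases lt_trichotomy t 0 with h | h | h <;> nlinarith
  | succ y hy' ih =>
    refine (ih (by omega) (by omega)).trans (affPerm_lt_of_not_isRightDescent w ?_)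
    rw [CoxeterSystem.IsRightDescent, not_lt]
    refine hw _ (Subgroup.subset_closure ⟨_, ?_, rfl⟩)
    intro h0
    obtain ⟨t, ht⟩ := intCast_eq_intCast_iff.1 (h0.trans Int.cast_zero.symm)
    rcases lt_trichotomy t 0 with h | h | h <;> nlinarith

theorem affPerm_image_Iic_of_mem_parabolic {v : AffineWeyl k} (hv : v ∈ parabolic k) :
    affPerm k v '' Set.Iic 0 = Set.Iic 0 := by
  induction hv using Subgroup.closure_induction with
  | mem v hv =>
    obtain ⟨i, hi, rfl⟩ := hv
    have hle : ∀ m : ℤ, m ≤ 0 → beadSwap k i m ≤ 0 := by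
      intro m hm
      unfold beadSwap
      split_ifs with h1 h2
      · rcases eq_or_lt_of_le hm with rfl | h
        · exact absurd (by simpa using h1.symm) hi
        · omega
      · omega
      · exact hm
    ext m
    simp only [Set.mem_image, Set.mem_Iic, affPerm_simple]
    exact ⟨fun ⟨x, hx, e⟩ => e ▸ hle x hx, fun h => ⟨_, hle m h, beadSwap_sq i m⟩⟩
  | one => simp
  | mul x y _ _ hx hy => rw [map_mul, Equiv.Perm.coe_mul, Set.image_comp, hy, hx]
  | inv x _ hx =>
    conv_lhs => rw [← hx]
    rw [← Set.image_comp, ← Equiv.Perm.coe_mul, ← map_mul, inv_mul_cancel]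
    simp

/-- An element increasing on `1, …, k + 1` lies in `W^0`: it agrees with the shortest element of
its coset. -/
theorem mem_minReps {w : AffineWeyl k}
    (h : ∀ x y, 0 < x → x < y → y ≤ (k : ℤ) + 1 → affPerm k w x < affPerm k w y) :
    w ∈ minReps k := by
  obtain ⟨v, hv, hmin⟩ := exists_minimalFor_of_wellFoundedLT (fun v => v ∈ parabolic k)
    (fun v => (coxSys k).length (w * v)) ⟨1, one_mem _⟩
  have hmin' : ∀ u ∈ parabolic k, (coxSys k).length (w * v) ≤ (coxSys k).length (w * u) := by
    intro u hu
    rcases le_total ((coxSys k).length (w * v)) ((coxSys k).length (w * u)) with h | h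
    · exact h
    · exact hmin hu h
  have hmem : w * v ∈ minReps k := fun u hu => by
    rw [mul_assoc]; exact hmin' _ (mul_mem hv hu)
  have e : w = w * v := by
    refine eq_of_image_Iic_eq h (affPerm_lt_of_mem_minReps hmem) ?_
    rw [map_mul, Equiv.Perm.coe_mul, Set.image_comp, affPerm_image_Iic_of_mem_parabolic hv]
  rw [e]; exact hmem

theorem IsCoreRep.unique {ν : YoungDiagram} {w w' : AffineWeyl k} (h : IsCoreRep k ν w)
    (h' : IsCoreRep k ν w') : w = w' := by
  refine eq_of_image_Iic_eq (affPerm_lt_of_mem_minReps h.1) (affPerm_lt_of_mem_minReps h'.1) ?_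
  rw [← beads_bot, ← beads_boxAct, ← beads_boxAct, h.2, h'.2]

/-! ### Reading words of skew shapes as affine permutations -/

/-- The word of contents of the cells of `κ/μ` in row `i`, read from right to left. -/
def rowWord (k : ℕ) (κ μ : YoungDiagram) (i : ℕ) : List (ZMod (k + 1)) :=
  ((List.range (κ.rowLen i)).reverse.filter fun j => μ.rowLen i ≤ j).map fun j => content k (i, j)

/-- The reading word of the part of `κ/μ` in the rows before row `l`. -/
def rowsWord (k : ℕ) (κ μ : YoungDiagram) (l : ℕ) : List (ZMod (k + 1)) :=
  (List.range l).reverse.flatMap (rowWord k κ μ)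

omit [NeZero k] in
theorem rowsWord_succ (κ μ : YoungDiagram) (l : ℕ) :
    rowsWord k κ μ (l + 1) = rowWord k κ μ l ++ rowsWord k κ μ l := by
  simp [rowsWord, List.range_succ]

theorem rowLen_eq_zero_of_colLen_le {κ : YoungDiagram} {i : ℕ} (h : κ.colLen 0 ≤ i) :
    κ.rowLen i = 0 := by
  by_contra h'
  have := YoungDiagram.mem_iff_lt_colLen.1
    (YoungDiagram.mem_iff_lt_rowLen.2 (Nat.pos_of_ne_zero h'))
  omega

omit [NeZero k] in
/-- Rows beyond the last row of `κ` contribute nothing to the reading word. -/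
theorem skewWord_eq_rowsWord (κ μ : YoungDiagram) {l : ℕ} (h : κ.colLen 0 ≤ l) :
    skewWord k κ μ = rowsWord k κ μ l := by
  induction l, h using Nat.le_induction with
  | base => rfl
  | succ l hl ih =>
    rw [ih, rowsWord_succ, rowWord, rowLen_eq_zero_of_colLen_le hl]; rfl

/-- On a window of `k + 1` consecutive integers, `s_b` is an honest transposition. -/
theorem affPerm_simple_window {L b x : ℤ} (hb : L < b) (hb' : b + 1 ≤ L + (k + 1)) (hx : L < x)
    (hx' : x ≤ L + (k + 1)) : affPerm k ((coxSys k).simple b) x =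
      if x = b then b + 1 else if x = b + 1 then b else x := by
  have key : ∀ y : ℤ, L < y → y ≤ L + (k + 1) → (x : ZMod (k + 1)) = y → x = y := by
    intro y h1 h2 h
    obtain ⟨t, ht⟩ := intCast_eq_intCast_iff.1 h
    rcases lt_trichotomy t 0 with h | h | h <;> nlinarith
  rw [affPerm_simple]
  split_ifs with h1 h2
  · rw [h1, beadSwap_of_eq rfl]
  · rw [h2, beadSwap_of_eq_add_one (by push_cast; rfl), add_sub_cancel_right]
  · refine beadSwap_of_ne (fun h => h1 (key _ hb (by omega) h)) (fun h => h2 (key _ (by omega) hb' ?_))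
    rw [h]; push_cast; rfl

/-- The row `i` of `κ/μ` acts on a window as a cycle: it moves the bead `μ_i - i` to `κ_i - i` and
shifts the integers it passes down by one. -/
theorem affPerm_rowWord {κ μ : YoungDiagram} {i : ℕ} {L x : ℤ} (hle : μ.rowLen i ≤ κ.rowLen i)
    (h1 : L < (μ.rowLen i : ℤ) - i) (h2 : (κ.rowLen i : ℤ) - i ≤ L + (k + 1)) (hx : L < x)
    (hx' : x ≤ L + (k + 1)) :
    affPerm k ((coxSys k).wordProd (rowWord k κ μ i)) x =
      if x = (μ.rowLen i : ℤ) - i then (κ.rowLen i : ℤ) - i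
      else if (μ.rowLen i : ℤ) - i < x ∧ x ≤ (κ.rowLen i : ℤ) - i then x - 1 else x := by
  rw [rowWord]
  generalize κ.rowLen i = n at hle h2 ⊢
  induction n, hle using Nat.le_induction with
  | base =>
    have : (List.range (μ.rowLen i)).reverse.filter (fun j => μ.rowLen i ≤ j) = [] := by
      rw [List.filter_eq_nil_iff]
      intro a ha
      simp at ha ⊢
      exact ha
    rw [this]
    simp only [List.map_nil, CoxeterSystem.wordProd_nil, map_one, Equiv.Perm.one_apply]
    split_ifs <;> omega
  | succ m hm ih =>
    have ih := ih (by push_cast at h2; omega)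
    rw [List.range_succ, List.reverse_append, List.reverse_singleton, List.singleton_append,
      List.filter_cons_of_pos (by simpa using hm), List.map_cons, CoxeterSystem.wordProd_cons,
      map_mul, Equiv.Perm.mul_apply, ih]
    have e : content k (i, m) = (((m : ℤ) - i : ℤ) : ZMod (k + 1)) := by
      simp [content]
    push_cast at h2 ⊢
    rw [e, affPerm_simple_window (L := L) (by omega) (by omega)]
    all_goals split_ifs <;> omega

/-- The effect of the reading word of `κ/μ` on the window `(-r, c]`, where `μ ⊆ κ ⊆ (c^r)`: the
beads of `μ` move to the beads of `κ`, and the other integers keep their order. -/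
theorem affPerm_rowsWord {c r : ℕ} (hk : r + c = k + 1) {κ μ : YoungDiagram}
    (hle : ∀ i, μ.rowLen i ≤ κ.rowLen i) (hc : ∀ i, κ.rowLen i ≤ c) {l : ℕ} (hl : l ≤ r) :
    (∀ x : ℤ, -r < x → x ≤ c →
      -r < affPerm k ((coxSys k).wordProd (rowsWord k κ μ l)) x ∧
        affPerm k ((coxSys k).wordProd (rowsWord k κ μ l)) x ≤ c) ∧
    (∀ i < l, affPerm k ((coxSys k).wordProd (rowsWord k κ μ l)) ((μ.rowLen i : ℤ) - i) =
      (κ.rowLen i : ℤ) - i) ∧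
    (∀ i, l ≤ i → i < r →
      affPerm k ((coxSys k).wordProd (rowsWord k κ μ l)) ((μ.rowLen i : ℤ) - i) =
        (μ.rowLen i : ℤ) - i) ∧
    (∀ x y : ℤ, -r < x → x < y → y ≤ c → (∀ i < l, x ≠ (μ.rowLen i : ℤ) - i) →
      (∀ i < l, y ≠ (μ.rowLen i : ℤ) - i) →
      affPerm k ((coxSys k).wordProd (rowsWord k κ μ l)) x <
        affPerm k ((coxSys k).wordProd (rowsWord k κ μ l)) y) := by
  induction l with
  | zero =>
    simp only [rowsWord, List.range_zero, List.reverse_nil, List.flatMap_nil,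
      CoxeterSystem.wordProd_nil, map_one, Equiv.Perm.one_apply]
    exact ⟨fun x h1 h2 => ⟨h1, h2⟩, fun i hi => absurd hi (Nat.not_lt_zero i), fun _ _ _ => trivial,
      fun x y _ h _ _ _ => h⟩
  | succ l ih =>
    obtain ⟨ih1, ih2, ih3, ih4⟩ := ih (by omega)
    have hL : (-r : ℤ) + (k + 1) = c := by
      have : (r : ℤ) + c = k + 1 := by exact_mod_cast hk
      omega
    have row : ∀ x : ℤ, -r < x → x ≤ c →
        affPerm k ((coxSys k).wordProd (rowWord k κ μ l)) x =
      if x = (μ.rowLen l : ℤ) - l then (κ.rowLen l : ℤ) - l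
      else if (μ.rowLen l : ℤ) - l < x ∧ x ≤ (κ.rowLen l : ℤ) - l then x - 1 else x := by
      intro x h1 h2
      have := hc l
      exact affPerm_rowWord (L := -r) (hle l) (by omega) (by omega) h1 (by omega)
    simp only [rowsWord_succ, CoxeterSystem.wordProd_append, map_mul, Equiv.Perm.mul_apply]
    set F := affPerm k ((coxSys k).wordProd (rowsWord k κ μ l)) with hF
    have hl1 := hle l
    have hl2 := hc l
    refine ⟨fun x h1 h2 => ?_, fun i hi => ?_, fun i hi hi' => ?_, fun x y hx hxy hy hxA hyA => ?_⟩
    · obtain ⟨h3, h4⟩ := ih1 x h1 h2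
      rw [row _ h3 h4]
      split_ifs <;> omega
    · rcases Nat.lt_succ_iff_lt_or_eq.1 hi with h | rfl
      · have h5 := κ.rowLen_anti i l h.le
        have := hc i
        rw [ih2 i h, row _ (by omega) (by omega), if_neg (by omega), if_neg (by omega)]
      · rw [ih3 i le_rfl (by omega), row _ (by omega) (by omega), if_pos rfl]
    · have h5 := μ.rowLen_anti l i (by omega)
      rw [ih3 i (by omega) hi', row _ (by omega) (by omega), if_neg (by omega), if_neg (by omega)]
    · have h1 := ih4 x y hx hxy hy (fun i hi => hxA i (by omega)) (fun i hi => hyA i (by omega))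
      have hne : ∀ z, (∀ i < l + 1, z ≠ (μ.rowLen i : ℤ) - i) → F z ≠ (μ.rowLen l : ℤ) - l := by
        intro z hz h
        rw [← ih3 l le_rfl (by omega)] at h
        exact hz l (by omega) (F.injective h)
      have h2 := hne x hxA
      have h3 := hne y hyA
      obtain ⟨h4, h5⟩ := ih1 x hx (by omega)
      obtain ⟨h6, h7⟩ := ih1 y (by omega) hy
      rw [row _ h4 h5, row _ h6 h7]
      split_ifs <;> omega

omit [NeZero k] in
theorem beadSwap_add (i : ZMod (k + 1)) (d m : ℤ) :
    beadSwap k (i + d) (m + d) = beadSwap k i m + d := by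
  have e1 : ((m + d : ℤ) : ZMod (k + 1)) = i + d ↔ (m : ZMod (k + 1)) = i := by
    push_cast; exact add_left_inj _
  have e2 : ((m + d : ℤ) : ZMod (k + 1)) = i + d + 1 ↔ (m : ZMod (k + 1)) = i + 1 := by
    rw [add_right_comm]; push_cast; exact add_left_inj _
  simp only [beadSwap, e1, e2]
  split_ifs <;> ring

/-- Rotating the indices of a word conjugates its affine permutation by a translation. -/
theorem affPerm_wordProd_map_add (ω : List (ZMod (k + 1))) (d m : ℤ) :
    affPerm k ((coxSys k).wordProd (ω.map (· + (d : ZMod (k + 1))))) (m + d) =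
      affPerm k ((coxSys k).wordProd ω) m + d := by
  induction ω with
  | nil => simp
  | cons i ω ih =>
    simp only [List.map_cons, CoxeterSystem.wordProd_cons, map_mul, Equiv.Perm.mul_apply] at ih ⊢
    rw [ih, affPerm_simple, affPerm_simple, beadSwap_add]

theorem rowLen_rect (c r i : ℕ) : (rect c r).rowLen i = if i < r then c else 0 := by
  refine eq_of_forall_lt_iff fun j => ?_
  rw [← YoungDiagram.mem_iff_lt_rowLen, ← YoungDiagram.mem_cells]
  simp only [rect, Finset.mem_product, Finset.mem_range]
  split_ifs with h <;> simp [h]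

theorem rowLen_le_of_mem_partsIn {c r : ℕ} {ν : YoungDiagram} (h : ν ∈ partsIn c r) (i : ℕ) :
    ν.rowLen i ≤ if i < r then c else 0 := by
  rw [← rowLen_rect]
  refine le_of_forall_lt fun j hj => ?_
  rw [← YoungDiagram.mem_iff_lt_rowLen] at hj ⊢
  exact h hj

theorem colLen_le_of_rowLen_eq_zero {μ : YoungDiagram} {r : ℕ} (h : μ.rowLen r = 0) :
    μ.colLen 0 ≤ r := by
  by_contra h'
  have := YoungDiagram.mem_iff_lt_rowLen.1 (YoungDiagram.mem_iff_lt_colLen.2 (not_le.1 h'))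
  omega

theorem rowLen_stack {c r : ℕ} {ν : YoungDiagram} (h : ν ∈ partsIn c r) (i : ℕ) :
    (stack c r ν).rowLen i = if i < r then c else ν.rowLen (i - r) := by
  refine eq_of_forall_lt_iff fun j => ?_
  rw [← YoungDiagram.mem_iff_lt_rowLen, ← YoungDiagram.mem_cells]
  simp only [stack, Finset.mem_union, Finset.mem_product, Finset.mem_range, Finset.mem_image,
    Finset.mem_filter, Prod.exists, Prod.mk.injEq, YoungDiagram.mem_cells,
    YoungDiagram.mem_iff_lt_rowLen]
  have h1 : ν.rowLen (i - r) ≤ c := by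
    have := rowLen_le_of_mem_partsIn h (i - r)
    split_ifs at this <;> omega
  by_cases h2 : i < r
  · rw [if_pos h2]
    constructor
    · rintro (h | ⟨a, b, h, rfl, rfl⟩) <;> omega
    · intro h; left; omega
  · rw [if_neg h2]
    constructor
    · rintro (h | ⟨a, b, h, rfl, rfl⟩)
      · omega
      · rw [Nat.add_sub_cancel]; exact h.1
    · intro h
      exact Or.inr ⟨i - r, j, ⟨h, by omega⟩, by omega, rfl⟩

omit [NeZero k] in
theorem rowWord_congr {κ κ' μ μ' : YoungDiagram} {i : ℕ} (h : κ.rowLen i = κ'.rowLen i)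
    (h' : μ.rowLen i = μ'.rowLen i) : rowWord k κ μ i = rowWord k κ' μ' i := by
  simp [rowWord, h, h']

omit [NeZero k] in
theorem readElt_eq_of_mem_partsIn {c r : ℕ} {ν : YoungDiagram} (h : ν ∈ partsIn c r) :
    readElt k ν ⊥ = (coxSys k).wordProd (rowsWord k ν ⊥ r) := by
  have := rowLen_le_of_mem_partsIn h r
  rw [if_neg (lt_irrefl r)] at this
  rw [readElt, skewWord_eq_rowsWord _ _ (colLen_le_of_rowLen_eq_zero (Nat.le_zero.1 this))]

omit [NeZero k] in
/-- The skew shape `(R, ν)/ν` consists of `R/ν` and, further down, a copy of `ν` whose contents are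
rotated by `c`. -/
theorem readElt_stack {c r : ℕ} (hk : r + c = k + 1) {ν : YoungDiagram} (h : ν ∈ partsIn c r) :
    readElt k (stack c r ν) ν =
      (coxSys k).wordProd ((rowsWord k ν ⊥ r).map (· + ((c : ℤ) : ZMod (k + 1)))) *
        (coxSys k).wordProd (rowsWord k (rect c r) ν r) := by
  have hr : ∀ i, r ≤ i → ν.rowLen i = 0 := by
    intro i hi
    have := rowLen_le_of_mem_partsIn h i
    rw [if_neg (by omega)] at this
    omega
  have hcol : (stack c r ν).colLen 0 ≤ r + r := by
    refine colLen_le_of_rowLen_eq_zero ?_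
    rw [rowLen_stack h, if_neg (by omega)]
    exact hr _ (by omega)
  have hcast : (r : ZMod (k + 1)) + c = 0 := by
    rw [← Nat.cast_add, hk]; exact ZMod.natCast_self _
  have first : ∀ l ≤ r, rowsWord k (stack c r ν) ν l = rowsWord k (rect c r) ν l := by
    intro l hl
    induction l with
    | zero => rfl
    | succ l ih =>
      rw [rowsWord_succ, rowsWord_succ, ih (by omega), rowWord_congr _ rfl]
      rw [rowLen_stack h, rowLen_rect, if_pos (by omega), if_pos (by omega)]
  have second : ∀ l, rowsWord k (stack c r ν) ν (r + l) =
      (rowsWord k ν ⊥ l).map (· + ((c : ℤ) : ZMod (k + 1))) ++ rowsWord k (rect c r) ν r := by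
    intro l
    induction l with
    | zero => exact first r le_rfl
    | succ l ih =>
      rw [← add_assoc, rowsWord_succ, rowsWord_succ, ih, List.map_append, List.append_assoc]
      congr 1
      rw [rowWord, rowWord, rowLen_stack h, if_neg (by omega), Nat.add_sub_cancel_left,
        hr _ (Nat.le_add_right r l), rowLen_bot, List.map_map]
      refine List.map_congr_left fun j _ => ?_
      simp only [content, Function.comp]
      push_cast
      linear_combination - hcast
  rw [readElt, skewWord_eq_rowsWord _ _ hcol, second, CoxeterSystem.wordProd_append]

/-! ### The element `w_ν` and the translation attached to `ν` -/

/-- The reading word of `ν` maps `0, -1, …, -r+1` to the beads of `ν`, and is increasing on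
`1, …, c`. -/
theorem affPerm_readElt {c r : ℕ} (hk : r + c = k + 1) {ν : YoungDiagram} (h : ν ∈ partsIn c r) :
    (∀ x : ℤ, -r < x → x ≤ c → -r < affPerm k (readElt k ν ⊥) x ∧ affPerm k (readElt k ν ⊥) x ≤ c) ∧
    (∀ i < r, affPerm k (readElt k ν ⊥) (-(i : ℤ)) = (ν.rowLen i : ℤ) - i) ∧
    (∀ x y : ℤ, 0 < x → x < y → y ≤ c →
      affPerm k (readElt k ν ⊥) x < affPerm k (readElt k ν ⊥) y) := by
  have hc : ∀ i, ν.rowLen i ≤ c := fun i => by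
    have := rowLen_le_of_mem_partsIn h i
    split_ifs at this <;> omega
  obtain ⟨h1, h2, -, h3⟩ := affPerm_rowsWord hk (κ := ν) (μ := ⊥)
    (fun i => by rw [rowLen_bot]; omega) hc (le_refl r)
  rw [← readElt_eq_of_mem_partsIn h] at h1 h2 h3
  simp only [rowLen_bot, Nat.cast_zero, zero_sub] at h2 h3
  exact ⟨h1, h2, fun x y hx hxy hy => h3 x y (by omega) hxy hy (by intros; omega) (by intros; omega)⟩

theorem affPerm_readElt_lt {c r : ℕ} (hk : r + c = k + 1) {ν : YoungDiagram}
    (h : ν ∈ partsIn c r) (x y : ℤ) (hx : 0 < x) (hxy : x < y) (hy : y ≤ (k : ℤ) + 1) :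
    affPerm k (readElt k ν ⊥) x < affPerm k (readElt k ν ⊥) y := by
  obtain ⟨h1, h2, h3⟩ := affPerm_readElt hk h
  have hk' : (r : ℤ) + c = k + 1 := by exact_mod_cast hk
  -- past `c`, the values are those at `0, -1, …` shifted by the period
  have tail : ∀ z : ℤ, c < z → z ≤ k + 1 → ∃ i : ℕ, i < r ∧ z = k + 1 - i ∧
      affPerm k (readElt k ν ⊥) z = ν.rowLen i - i + (k + 1) := by
    intro z hz hz'
    refine ⟨(k + 1 - z).toNat, by omega, by omega, ?_⟩
    have := affPerm_add_period (readElt k ν ⊥) (-((k + 1 - z).toNat : ℤ)) 1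
    rw [h2 _ (by omega)] at this
    rw [mul_one] at this
    rw [← this]
    congr 1
    omega
  rcases le_or_gt y c with hyc | hyc
  · exact h3 x y hx hxy hyc
  · obtain ⟨i, hi, hi', ei⟩ := tail y hyc hy
    rw [ei]
    rcases le_or_gt x c with hxc | hxc
    · have := (h1 x (by omega) hxc).2
      omega
    · obtain ⟨j, hj, hj', ej⟩ := tail x hxc (by omega)
      rw [ej]
      have := ν.rowLen_anti i j (by omega)
      omega

/-- The reading word of `ν` is a word of `w_ν`. -/
theorem isCoreRep_readElt {c r : ℕ} (hk : r + c = k + 1) {ν : YoungDiagram}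
    (h : ν ∈ partsIn c r) : IsCoreRep k ν (readElt k ν ⊥) := by
  refine ⟨mem_minReps (affPerm_readElt_lt hk h), beads_injective ?_⟩
  obtain ⟨h1, h2, -⟩ := affPerm_readElt hk h
  have hk' : (r : ℤ) + c = k + 1 := by exact_mod_cast hk
  rw [beads_boxAct, beads_bot]
  set U := affPerm k (readElt k ν ⊥) with hU
  have hzero : ∀ i, r ≤ i → ν.rowLen i = 0 := by
    intro i hi
    have := rowLen_le_of_mem_partsIn h i
    rw [if_neg (by omega)] at this
    omega
  -- the window `(-r, c]` is preserved, hence so is everything below it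
  have low : ∀ x : ℤ, x ≤ -r → U x ≤ -r := by
    intro x hx
    obtain ⟨y, t, hy1, hy2, rfl⟩ := exists_eq_add_period (k := k) (-r) x
    have h4 := h1 y hy1 (by omega)
    rw [hU, affPerm_add_period, ← hU]
    have : t < 0 := by by_contra ht; nlinarith
    nlinarith
  have high : ∀ x : ℤ, -r < x → -r < U x := by
    intro x hx
    obtain ⟨y, t, hy1, hy2, rfl⟩ := exists_eq_add_period (k := k) (-r) x
    have h4 := h1 y hy1 (by omega)
    rw [hU, affPerm_add_period, ← hU]
    have : 0 ≤ t := by by_contra ht; nlinarith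
    nlinarith
  ext m
  constructor
  · rintro ⟨x, hx, rfl⟩
    rcases le_or_gt x (-r) with hx' | hx'
    · have := low x hx'
      refine ⟨(- U x).toNat, ?_⟩
      simp only
      rw [hzero _ (by omega)]
      omega
    · refine ⟨(-x).toNat, ?_⟩
      have := h2 (-x).toNat (by have : x ≤ 0 := hx; omega)
      simp only
      rw [← this]
      congr 1
      have : x ≤ 0 := hx
      omega
  · rintro ⟨i, rfl⟩
    simp only
    rcases lt_or_ge i r with hi | hi
    · exact ⟨-i, by simp, h2 i hi⟩
    · rw [hzero i hi]
      obtain ⟨x, hx⟩ := U.surjective ((0 : ℕ) - i)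
      refine ⟨x, ?_, hx⟩
      by_contra h5
      have := high x (by simp at h5; omega)
      omega

theorem coreRep_eq {c r : ℕ} (hk : r + c = k + 1) {ν : YoungDiagram} (h : ν ∈ partsIn c r) :
    coreRep k ν = readElt k ν ⊥ :=
  (Classical.epsilon_spec (p := IsCoreRep k ν) ⟨_, isCoreRep_readElt hk h⟩).unique
    (isCoreRep_readElt hk h)

/-- The indicator of the integers congruent to one of `1, …, c`. -/
def weightInd (k c : ℕ) (m : ℤ) : ℤ := if (m - 1) % ((k : ℤ) + 1) < c then 1 else 0

omit [NeZero k] in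
theorem weightInd_add_period (c : ℕ) (m t : ℤ) :
    weightInd k c (m + (k + 1) * t) = weightInd k c m := by
  rw [weightInd, weightInd, show m + ((k : ℤ) + 1) * t - 1 = m - 1 + (k + 1) * t by ring,
    Int.add_mul_emod_self_left]

omit [NeZero k] in
theorem weightInd_window {c r : ℕ} (hk : r + c = k + 1) {x : ℤ} (h1 : -r < x) (h2 : x ≤ c) :
    weightInd k c x = if 0 < x then 1 else 0 := by
  have hk' : (r : ℤ) + c = k + 1 := by exact_mod_cast hk
  rw [weightInd]
  split_ifs with h3 h4 h4
  · rfl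
  · rw [← Int.add_emod_right, Int.emod_eq_of_lt (by omega) (by omega)] at h3
    omega
  · rw [Int.emod_eq_of_lt (by omega) (by omega)] at h3
    omega
  · rfl

/-- The reading words of `ν` and of `R/ν` together give the affine permutation of `w_R`, which
exchanges the blocks `(-r, 0]` and `(0, c]` of the window. -/
theorem affPerm_rect_mul {c r : ℕ} (hk : r + c = k + 1) {ν : YoungDiagram} (h : ν ∈ partsIn c r)
    (x : ℤ) : affPerm k ((coxSys k).wordProd (rowsWord k (rect c r) ν r))
      (affPerm k (readElt k ν ⊥) x) = x + c - (k + 1) * weightInd k c x := by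
  have hk' : (r : ℤ) + c = k + 1 := by exact_mod_cast hk
  obtain ⟨y, t, hy1, hy2, rfl⟩ := exists_eq_add_period (k := k) (-r) x
  rw [affPerm_add_period, affPerm_add_period, weightInd_add_period]
  suffices affPerm k ((coxSys k).wordProd (rowsWord k (rect c r) ν r))
      (affPerm k (readElt k ν ⊥) y) = y + c - (k + 1) * weightInd k c y by linear_combination this
  rw [weightInd_window hk hy1 (by omega)]
  obtain ⟨h1, h2, h3⟩ := affPerm_readElt hk h
  obtain ⟨g1, g2, -, g3⟩ := affPerm_rowsWord hk (κ := rect c r) (μ := ν)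
    (fun i => by rw [rowLen_rect]; exact rowLen_le_of_mem_partsIn h i)
    (fun i => by rw [rowLen_rect]; split_ifs <;> omega) (le_refl r)
  set U := affPerm k (readElt k ν ⊥)
  set V := affPerm k ((coxSys k).wordProd (rowsWord k (rect c r) ν r))
  have top : ∀ i < r, V (U (-(i : ℤ))) = c - i := by
    intro i hi
    rw [h2 i hi, g2 i hi, rowLen_rect, if_pos hi]
  split_ifs with hy
  · have hne : ∀ z : ℤ, 0 < z → ∀ i < r, U z ≠ (ν.rowLen i : ℤ) - i := by
      intro z hz i hi e
      rw [← h2 i hi] at e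
      have := U.injective e
      omega
    have key := eq_add_of_strictMonoOn (f := fun z => V (U z)) (a := 0) (b := c) (d := -r)
      (fun z z' hz hzz hz' => g3 _ _ (h1 z (by omega) (by omega)).1 (h3 z z' hz hzz hz')
        (h1 z' (by omega) hz').2 (hne z hz) (hne z' (by omega))) (fun z hz hz' => ?_) hy (by omega)
    · rw [key]; omega
    · obtain ⟨g4, g5⟩ := g1 _ (h1 z (by omega) hz').1 (h1 z (by omega) hz').2
      refine ⟨by simpa using g4, ?_⟩
      by_contra hc
      have h6 := top (c - V (U z)).toNat (by omega)
      have h7 : V (U (-((c - V (U z)).toNat : ℤ))) = V (U z) := by rw [h6]; omega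
      have := U.injective (V.injective h7)
      omega
  · have := top (-y).toNat (by omega)
    rw [show -((-y).toNat : ℤ) = y by omega] at this
    rw [this]; omega

/-- The affine permutation of `V_{(R,ν)/ν}`: conjugating that of `w_R` by `w_ν`, up to the rotation
by `c`, gives a pseudo-translation. -/
theorem affPerm_readElt_stack {c r : ℕ} (hk : r + c = k + 1) {ν : YoungDiagram}
    (h : ν ∈ partsIn c r) (m : ℤ) : affPerm k (readElt k (stack c r ν) ν) m =
      m + c - (k + 1) * weightInd k c ((affPerm k (readElt k ν ⊥))⁻¹ m) := by
  obtain ⟨x, rfl⟩ := (affPerm k (readElt k ν ⊥)).surjective m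
  rw [readElt_stack hk h, map_mul, Equiv.Perm.mul_apply, affPerm_rect_mul hk h,
    Equiv.Perm.inv_def, Equiv.symm_apply_apply]
  have := affPerm_wordProd_map_add (rowsWord k ν ⊥ r) c (x + (k + 1) * (- weightInd k c x))
  rw [← readElt_eq_of_mem_partsIn h, affPerm_add_period] at this
  rw [show x + c - ((k : ℤ) + 1) * weightInd k c x = x + (k + 1) * (- weightInd k c x) + c by ring,
    this]
  ring

/-! ### The two actions on `V` in terms of affine permutations -/

omit [NeZero k] in
theorem toV_eq_toV_iff {a b : ZMod (k + 1) → ℝ} : toV k a = toV k b ↔ ∃ t : ℝ, ∀ x, a x = b x + t := by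
  rw [toV, Submodule.mkQ_apply, Submodule.mkQ_apply, Submodule.Quotient.eq,
    Submodule.mem_span_singleton]
  constructor
  · rintro ⟨t, ht⟩
    refine ⟨t, fun x => ?_⟩
    have := congrFun ht x
    simp at this
    linarith
  · rintro ⟨t, ht⟩
    refine ⟨t, funext fun x => ?_⟩
    simp [ht x]

/-- The extension of a vector `(a_1, …, a_{k+1})` to all integer indices with
`a_{m+k+1} = a_m - 1`. The coordinate `a_m` is stored at the residue `m - 1`. -/
noncomputable def extend (k : ℕ) (a : ZMod (k + 1) → ℝ) (m : ℤ) : ℝ :=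
  a ((m - 1 : ℤ) : ZMod (k + 1)) - ((m - 1) / ((k : ℤ) + 1) : ℤ)

omit [NeZero k] in
theorem extend_add_period (a : ZMod (k + 1) → ℝ) (m t : ℤ) :
    extend k a (m + (k + 1) * t) = extend k a m - t := by
  have h1 : ((m + (k + 1) * t - 1 : ℤ) : ZMod (k + 1)) = ((m - 1 : ℤ) : ZMod (k + 1)) :=
    intCast_eq_intCast_iff.2 ⟨-t, by ring⟩
  have h2 : (m + ((k : ℤ) + 1) * t - 1) / ((k : ℤ) + 1) = (m - 1) / ((k : ℤ) + 1) + t := by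
    rw [show m + ((k : ℤ) + 1) * t - 1 = m - 1 + (k + 1) * t by ring,
      Int.add_mul_ediv_left _ _ (by omega)]
  rw [extend, extend, h1, h2]
  push_cast; ring

omit [NeZero k] in
theorem ediv_eq_pred_ediv_add (m : ℤ) : m / ((k : ℤ) + 1) =
    (m - 1) / ((k : ℤ) + 1) + if (m : ZMod (k + 1)) = 0 then 1 else 0 := by
  have hk : (0 : ℤ) < k + 1 := by omega
  have e : (m : ZMod (k + 1)) = 0 ↔ ((k : ℤ) + 1) ∣ m := by
    rw [ZMod.intCast_zmod_eq_zero_iff_dvd]; push_cast; rfl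
  obtain ⟨y, t, h1, h2, rfl⟩ := exists_eq_add_period (k := k) 0 m
  rw [show y + ((k : ℤ) + 1) * t - 1 = y - 1 + (k + 1) * t by ring,
    Int.add_mul_ediv_left _ _ hk.ne', Int.add_mul_ediv_left _ _ hk.ne',
    Int.ediv_eq_zero_of_lt (a := y - 1) (by omega) (by omega)]
  rcases eq_or_lt_of_le h2 with h | h
  · rw [if_pos (e.2 ⟨t + 1, by rw [h]; ring⟩), h, zero_add, Int.ediv_self hk.ne']
    ring
  · rw [if_neg, Int.ediv_eq_zero_of_lt (by omega) (by omega)]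
    · ring
    · rw [e]
      intro hd
      have := Int.le_of_dvd h1 ((Int.dvd_add_left (Dvd.intro t rfl)).1 hd)
      omega

theorem swap_sub_one (i : ZMod (k + 1)) (m : ℤ) :
    Equiv.swap (i - 1) i ((m - 1 : ℤ) : ZMod (k + 1)) = ((beadSwap k i m - 1 : ℤ) : ZMod (k + 1)) := by
  by_cases h1 : (m : ZMod (k + 1)) = i
  · rw [beadSwap_of_eq h1]; push_cast; rw [h1]; simp
  · by_cases h2 : (m : ZMod (k + 1)) = i + 1
    · rw [beadSwap_of_eq_add_one h2]; push_cast; rw [h2]; simp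
    · rw [beadSwap_of_ne h1 h2, Equiv.swap_apply_of_ne_of_ne] <;> push_cast <;> intro h
      · exact h1 (by linear_combination h)
      · exact h2 (by linear_combination h)

theorem extend_diamondGen (i : ZMod (k + 1)) (a : ZMod (k + 1) → ℝ) (m : ℤ) :
    extend k (fun x => a (Equiv.swap (i - 1) i x) + shift k i x) m = extend k a (beadSwap k i m) := by
  have h10 := one_ne_zero_idx k
  simp only [extend, swap_sub_one, shift_apply]
  by_cases h1 : (m : ZMod (k + 1)) = i
  · have h3 := ediv_eq_pred_ediv_add (k := k) m
    rw [beadSwap_of_eq h1, add_sub_cancel_right, h3, h1]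
    push_cast
    rw [h1]
    by_cases hi : i = 0
    · simp [hi, h10]; ring
    · simp [hi]
  · by_cases h2 : (m : ZMod (k + 1)) = i + 1
    · have h3 := ediv_eq_pred_ediv_add (k := k) (m - 1)
      have h4 : ((m - 1 : ℤ) : ZMod (k + 1)) = i := by push_cast; rw [h2]; ring
      rw [beadSwap_of_eq_add_one h2, h3, h4]
      by_cases hi : i = 0
      · have : (0 : ZMod (k + 1)) ≠ -1 := fun h => h10 (by linear_combination h)
        simp [hi, this]
      · simp [hi]
    · rw [beadSwap_of_ne h1 h2]
      have h3 : i = 0 → ((m - 1 : ℤ) : ZMod (k + 1)) ≠ 0 := by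
        rintro rfl h; push_cast at h; exact h2 (by linear_combination h)
      have h4 : i = 0 → ((m - 1 : ℤ) : ZMod (k + 1)) ≠ -1 := by
        rintro rfl h; push_cast at h; exact h1 (by linear_combination h)
      split_ifs <;> simp_all

theorem diamondAct_toV (w : AffineWeyl k) (a : ZMod (k + 1) → ℝ) :
    ∃ b, diamondAct k w (toV k a) = toV k b ∧
      ∀ m, extend k b m = extend k a ((affPerm k w)⁻¹ m) := by
  induction w using (coxSys k).simple_induction_left with
  | one => exact ⟨a, by simp, by simp⟩
  | mul_simple_left w i ih =>
    obtain ⟨b, hb, hb'⟩ := ih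
    refine ⟨fun x => b (Equiv.swap (i - 1) i x) + shift k i x, ?_, fun m => ?_⟩
    · have : diamondAct k ((coxSys k).simple i) = diamondGen k i := by
        rw [diamondAct, CoxeterSystem.lift_apply_simple]
      rw [map_mul, Equiv.Perm.mul_apply, hb, this, diamondGen_toV]
    · rw [map_mul, mul_inv_rev, Equiv.Perm.mul_apply, affPerm_simple_inv, ← hb', ← extend_diamondGen]

theorem starAct_toV (w : AffineWeyl k) : ∃ π : Equiv.Perm (ZMod (k + 1)),
    (∀ a, starAct k w (toV k a) = toV k fun x => a (π x)) ∧
      ∀ m : ℤ, π ((m - 1 : ℤ) : ZMod (k + 1)) = (((affPerm k w)⁻¹ m - 1 : ℤ) : ZMod (k + 1)) := by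
  induction w using (coxSys k).simple_induction_left with
  | one => exact ⟨1, by simp, by simp⟩
  | mul_simple_left w i ih =>
    obtain ⟨π, h1, h2⟩ := ih
    refine ⟨π * Equiv.swap (i - 1) i, fun a => ?_, fun m => ?_⟩
    · have : starAct k ((coxSys k).simple i) = starGen k i := by
        rw [starAct, CoxeterSystem.lift_apply_simple]
      rw [map_mul, LinearEquiv.mul_apply, h1, this, starGen_toV]
      rfl
    · rw [map_mul, mul_inv_rev, Equiv.Perm.mul_apply, Equiv.Perm.mul_apply, swap_sub_one, h2,
        affPerm_simple_inv]

omit [NeZero k] in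
theorem extend_natCast_add_one (a : ZMod (k + 1) → ℝ) (i : ZMod (k + 1)) :
    extend k a ((i.val : ℤ) + 1) = a i := by
  have h := ZMod.val_lt i
  rw [extend, add_sub_cancel_right, Int.ediv_eq_zero_of_lt (by omega) (by omega)]
  simp

omit [NeZero k] in
/-- The fundamental alcove consists of the classes of vectors whose extension is decreasing. -/
theorem toV_mem_fundAlcove {a : ZMod (k + 1) → ℝ} :
    toV k a ∈ fundAlcove k ↔ Antitone (extend k a) := by
  have zero : ∀ a : ZMod (k + 1) → ℝ, extend k a 0 = a (-1) + 1 := by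
    intro a
    have : (0 - 1 : ℤ) / ((k : ℤ) + 1) = -1 := by
      rw [zero_sub, Int.neg_one_ediv, Int.sign_eq_one_of_pos (by omega)]
    rw [extend, this]
    push_cast
    ring_nf
  have one : ∀ a : ZMod (k + 1) → ℝ, extend k a 1 = a 0 := by
    intro a
    simp [extend]
  constructor
  · rintro ⟨b, ⟨h1, h2⟩, e⟩
    obtain ⟨t, ht⟩ := toV_eq_toV_iff.1 e
    have hb : Antitone (extend k b) := by
      refine antitone_int_of_succ_le fun m => ?_
      obtain ⟨y, s, hy1, hy2, rfl⟩ := exists_eq_add_period (k := k) (-1) m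
      rw [add_right_comm, extend_add_period, extend_add_period]
      refine sub_le_sub_right ?_ _
      rcases eq_or_lt_of_le (show 0 ≤ y by omega) with rfl | hy
      · rw [zero_add, zero, one]; linarith
      · have e1 : ∀ z : ℤ, 0 < z → z ≤ k + 1 → ∃ i : ZMod (k + 1), z = i.val + 1 := by
          intro z h h'
          refine ⟨((z - 1).toNat : ℕ), ?_⟩
          rw [ZMod.val_natCast_of_lt (by omega)]; omega
        obtain ⟨i, hi⟩ := e1 y hy (by omega)
        obtain ⟨j, hj⟩ := e1 (y + 1) (by omega) (by omega)
        rw [hj, hi, extend_natCast_add_one, extend_natCast_add_one]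
        exact h1 i j (by omega)
    intro x y hxy
    have := hb hxy
    simp only [extend, ht] at this ⊢
    linarith
  · intro h
    refine ⟨a, ⟨fun i j hij => ?_, ?_⟩, rfl⟩
    · rw [← extend_natCast_add_one a i, ← extend_natCast_add_one a j]
      exact h (by omega)
    · have := h (show (0 : ℤ) ≤ 1 by omega)
      rw [zero, one] at this
      linarith

omit [NeZero k] in
theorem mem_alcove {w : AffineWeyl k} {v : VSpace k} :
    v ∈ alcove k w ↔ diamondAct k w v ∈ fundAlcove k := by
  rw [alcove, map_inv, Equiv.Perm.inv_def, Equiv.image_symm_eq_preimage]; rfl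

theorem toV_mem_alcove {w : AffineWeyl k} {a : ZMod (k + 1) → ℝ} :
    toV k a ∈ alcove k w ↔ Antitone fun m => extend k a ((affPerm k w)⁻¹ m) := by
  obtain ⟨b, hb, hb'⟩ := diamondAct_toV w a
  rw [mem_alcove, hb, toV_mem_fundAlcove]
  simp only [← hb']

/-- Distinct elements of `W` have distinct alcoves. -/
theorem alcove_injective : Function.Injective (alcove k) := by
  intro y w h
  -- the point of the fundamental alcove whose extension is `m ↦ (1 - m) / (k + 1)`
  let p : ZMod (k + 1) → ℝ := fun x => -(x.val : ℝ) / (k + 1)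
  have hp : ∀ m, extend k p m = (1 - m : ℝ) / (k + 1) := by
    intro m
    have h1 : (((m - 1 : ℤ) : ZMod (k + 1)).val : ℤ) = (m - 1) % (k + 1) := by
      rw [ZMod.val_intCast]; push_cast; rfl
    have h2 := Int.emod_add_mul_ediv (m - 1) (k + 1)
    rw [← h1] at h2
    have h3 : ((((m - 1 : ℤ) : ZMod (k + 1)).val : ℝ)) +
        (k + 1) * (((m - 1) / ((k : ℤ) + 1) : ℤ) : ℝ) = m - 1 := by exact_mod_cast h2
    have hk : (k : ℝ) + 1 ≠ 0 := by positivity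
    simp only [extend, p]
    field_simp
    linarith
  obtain ⟨b, hb, hb'⟩ := diamondAct_toV y⁻¹ p
  have h1 : toV k b ∈ alcove k y := by
    rw [mem_alcove, ← hb, ← Equiv.Perm.mul_apply, ← map_mul, mul_inv_cancel, map_one,
      Equiv.Perm.one_apply, toV_mem_fundAlcove]
    intro x z hxz
    rw [hp, hp]
    have : (x : ℝ) ≤ z := by exact_mod_cast hxz
    gcongr
  rw [h, toV_mem_alcove] at h1
  simp only [hb', hp, map_inv, inv_inv] at h1
  have h2 : StrictMono (affPerm k (y * w⁻¹)) := by
    refine Monotone.strictMono_of_injective (fun x z hxz => ?_) (Equiv.injective _)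
    have h3 := h1 hxz
    rw [map_mul, map_inv, Equiv.Perm.mul_apply, Equiv.Perm.mul_apply]
    simp only at h3
    rw [div_le_div_iff_of_pos_right (by positivity)] at h3
    have : ((affPerm k y ((affPerm k w)⁻¹ x) : ℤ) : ℝ) ≤ (affPerm k y ((affPerm k w)⁻¹ z) : ℤ) := by
      linarith
    exact_mod_cast this
  exact mul_inv_eq_one.1 (eq_one_of_strictMono h2)

theorem IsPseudoTranslation.unique {y y' w : AffineWeyl k} {η : VSpace k}
    (h : IsPseudoTranslation k y w η) (h' : IsPseudoTranslation k y' w η) : y = y' :=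
  mul_right_cancel (alcove_injective (h.trans h'.symm))

/-- Adding an integer `g_m` to the coordinate `m` amounts to replacing the index `m` by
`m - (k + 1) g_m`; so an affine permutation that does this, up to a rotation, translates the
fundamental alcove by `g`. -/
theorem isPseudoTranslation_of_affPerm {y : AffineWeyl k} {g : ZMod (k + 1) → ℝ} {G : ℤ → ℤ} {d : ℤ}
    (hg : ∀ m : ℤ, g ((m - 1 : ℤ) : ZMod (k + 1)) = G m)
    (hy : ∀ m, affPerm k y m = m + d - (k + 1) * G m) : IsPseudoTranslation k y 1 (toV k g) := by
  ext v
  obtain ⟨a, rfl⟩ := Submodule.mkQ_surjective _ v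
  change toV k a ∈ _ ↔ toV k a ∈ _
  have h1 : toV k a ∈ (fun v => v + toV k g) '' alcove k 1 ↔ toV k (a - g) ∈ alcove k 1 := by
    rw [map_sub]
    constructor
    · rintro ⟨u, hu, e⟩
      rwa [← e, add_sub_cancel_right]
    · intro h
      exact ⟨_, h, sub_add_cancel _ _⟩
  rw [h1, mul_one, toV_mem_alcove, toV_mem_alcove]
  have h2 : ∀ m, extend k a ((affPerm k y)⁻¹ m) = extend k (a - g) (m - d) := by
    intro m
    obtain ⟨x, rfl⟩ := (affPerm k y).surjective m
    rw [Equiv.Perm.inv_def, Equiv.symm_apply_apply, hy,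
      show x + d - ((k : ℤ) + 1) * G x - d = x + (k + 1) * (- G x) by ring, extend_add_period]
    simp only [extend, Pi.sub_apply, hg]
    push_cast; ring
  simp only [h2, map_one, inv_one, Equiv.Perm.one_apply]
  constructor
  · intro h x z hxz
    simpa using h (add_le_add_left hxz d)
  · intro h x z hxz
    exact h (sub_le_sub_right hxz d)

/-! ### The bijection between partitions in the rectangle and 0/1 vectors -/

/-- The diagram inside `(c^r)` with prescribed row lengths. -/
def ofRows (c r : ℕ) (ρ : ℕ → ℕ) (h : Antitone ρ) : YoungDiagram where
  cells := (Finset.range r ×ˢ Finset.range c).filter fun b => b.2 < ρ b.1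
  isLowerSet := by
    rintro ⟨i, j⟩ ⟨i', j'⟩ ⟨hi, hj⟩ hb
    simp only [Finset.coe_filter, Finset.mem_product, Finset.mem_range, Set.mem_ofPred_eq]
      at hb hi hj ⊢
    have := h hi
    omega

theorem ofRows_mem_partsIn (c r : ℕ) (ρ : ℕ → ℕ) (h : Antitone ρ) : ofRows c r ρ h ∈ partsIn c r :=
  fun _ hb => Finset.filter_subset _ _ hb

theorem rowLen_ofRows {c r : ℕ} {ρ : ℕ → ℕ} (h : Antitone ρ) (hc : ∀ i, ρ i ≤ c)
    (hr : ∀ i, r ≤ i → ρ i = 0) (i : ℕ) : (ofRows c r ρ h).rowLen i = ρ i := by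
  refine eq_of_forall_lt_iff fun j => ?_
  rw [← YoungDiagram.mem_iff_lt_rowLen, ← YoungDiagram.mem_cells]
  simp only [ofRows, Finset.mem_filter, Finset.mem_product, Finset.mem_range]
  refine ⟨fun h => h.2, fun h => ⟨⟨?_, h.trans_le (hc i)⟩, h⟩⟩
  by_contra h'
  rw [hr i (by omega)] at h
  omega

theorem mem_beads_iff_of_mem_partsIn {c r : ℕ} {ν : YoungDiagram} (h : ν ∈ partsIn c r) (m : ℤ) :
    m ∈ beads ν ↔ m ≤ -r ∨ m ≤ c ∧ ∃ i < r, (ν.rowLen i : ℤ) - i = m := by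
  constructor
  · rintro ⟨i, rfl⟩
    have := rowLen_le_of_mem_partsIn h i
    simp only
    split_ifs at this with hi
    · exact Or.inr ⟨by omega, i, hi, rfl⟩
    · left; omega
  · rintro (hm | ⟨-, i, -, rfl⟩)
    · refine ⟨(-m).toNat, ?_⟩
      have := rowLen_le_of_mem_partsIn h (-m).toNat
      rw [if_neg (by omega)] at this
      simp only
      omega
    · exact ⟨i, rfl⟩

/-- On the window `(-r, c]`, the 0/1 sequence `m ↦ Λ_c(w_ν⁻¹ m)` vanishes exactly at the beads of
`ν`. -/
theorem weightInd_inv_readElt {c r : ℕ} (hk : r + c = k + 1) {ν : YoungDiagram}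
    (h : ν ∈ partsIn c r) {m : ℤ} (hm : -r < m) (hm' : m ≤ c) :
    (weightInd k c ((affPerm k (readElt k ν ⊥))⁻¹ m) = 0 ∧ m ∈ beads ν) ∨
      (weightInd k c ((affPerm k (readElt k ν ⊥))⁻¹ m) = 1 ∧ m ∉ beads ν) := by
  have hk' : (r : ℤ) + c = k + 1 := by exact_mod_cast hk
  obtain ⟨h1, h2, -⟩ := affPerm_readElt hk h
  obtain ⟨x, rfl⟩ := (affPerm k (readElt k ν ⊥)).surjective m
  rw [Equiv.Perm.inv_def, Equiv.symm_apply_apply]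
  obtain ⟨y, t, hy1, hy2, rfl⟩ := exists_eq_add_period (k := k) (-r) x
  obtain ⟨h3, h4⟩ := h1 y hy1 (by omega)
  rw [affPerm_add_period] at hm hm'
  have ht : t = 0 := by
    rcases lt_trichotomy t 0 with h | h | h
    · nlinarith
    · exact h
    · nlinarith
  subst ht
  simp only [mul_zero, add_zero] at hm hm' ⊢
  rw [weightInd_window hk hy1 (by omega), mem_beads_iff_of_mem_partsIn h]
  split_ifs with hy
  · refine Or.inr ⟨rfl, ?_⟩
    rintro (h5 | ⟨-, i, hi, h5⟩)
    · omega
    · rw [← h2 i hi] at h5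
      have := (affPerm k (readElt k ν ⊥)).injective h5
      omega
  · refine Or.inl ⟨rfl, Or.inr ⟨hm', (-y).toNat, by omega, ?_⟩⟩
    rw [← h2 _ (by omega)]
    congr 1; omega

omit [NeZero k] in
theorem sum_fundWeight {c r : ℕ} (hk : r + c = k + 1) :
    ∑ x : ZMod (k + 1), (if x.val < c then 1 else 0 : ℝ) = c := by
  rw [Finset.sum_boole]
  congr 1
  change (Finset.univ.filter fun x : Fin (k + 1) => x.val < c).card = c
  rw [Fin.card_filter_val_lt]
  omega

theorem psi_eq {c r : ℕ} (hk : r + c = k + 1) {ν : YoungDiagram} (h : ν ∈ partsIn c r) :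
    ∃ g : ZMod (k + 1) → ℝ, psi k c ν = toV k g ∧ (∀ x, g x = 0 ∨ g x = 1) ∧ ∑ x, g x = c ∧
      ∀ m : ℤ, g ((m - 1 : ℤ) : ZMod (k + 1)) =
        (weightInd k c ((affPerm k (readElt k ν ⊥))⁻¹ m) : ℤ) := by
  obtain ⟨π, h1, h2⟩ := starAct_toV (readElt k ν ⊥)
  refine ⟨fun x => if (π x).val < c then 1 else 0, ?_, fun x => ?_, ?_, fun m => ?_⟩
  · rw [psi, coreRep_eq hk h, fundWeight, h1]
  · simp only
    split_ifs <;> simp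
  · rw [Equiv.sum_comp π fun x => if x.val < c then (1 : ℝ) else 0, sum_fundWeight hk]
  · simp only [h2, weightInd]
    set x := (affPerm k (readElt k ν ⊥))⁻¹ m
    have h3 : (((x - 1 : ℤ) : ZMod (k + 1)).val : ℤ) = (x - 1) % (k + 1) := by
      rw [ZMod.val_intCast]; push_cast; rfl
    rw [← h3]
    simp only [Nat.cast_lt]
    split_ifs <;> simp

omit [NeZero k] in
/-- Vectors with a given coordinate sum are determined by their classes in `V`. -/
theorem eq_of_toV_eq {a b : ZMod (k + 1) → ℝ} (h : toV k a = toV k b) (hs : ∑ x, a x = ∑ x, b x) :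
    a = b := by
  obtain ⟨t, ht⟩ := toV_eq_toV_iff.1 h
  simp only [ht, Finset.sum_add_distrib, Finset.sum_const, Finset.card_univ, ZMod.card,
    nsmul_eq_mul, add_eq_left, mul_eq_zero] at hs
  have ht0 : t = 0 := hs.resolve_left (by positivity)
  funext x
  rw [ht, ht0, add_zero]

theorem isPseudoTranslation_readElt_stack {c r : ℕ} (hk : r + c = k + 1) {ν : YoungDiagram}
    (h : ν ∈ partsIn c r) :
    IsPseudoTranslation k (readElt k (stack c r ν) ν) 1 (psi k c ν) := by
  obtain ⟨g, hg, -, -, hg'⟩ := psi_eq hk h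
  rw [hg]
  exact isPseudoTranslation_of_affPerm hg' (affPerm_readElt_stack hk h)

theorem pseudoTrans_eq {γ : VSpace k} {y : AffineWeyl k} (h : IsPseudoTranslation k y 1 γ) :
    pseudoTrans k γ = y :=
  (Classical.epsilon_spec (p := fun y => IsPseudoTranslation k y 1 γ) ⟨y, h⟩).unique h

theorem mapsTo_psi {c r : ℕ} (hk : r + c = k + 1) :
    Set.MapsTo (psi k c) (partsIn c r) (Gam k c) := by
  intro ν h
  obtain ⟨g, hg, h01, hs, -⟩ := psi_eq hk h
  exact ⟨g, ⟨h01, hs⟩, hg.symm⟩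

theorem injOn_psi {c r : ℕ} (hk : r + c = k + 1) : Set.InjOn (psi k c) (partsIn c r) := by
  intro ν h ν' h' e
  obtain ⟨g, hg, -, hs, hm⟩ := psi_eq hk h
  obtain ⟨g', hg', -, hs', hm'⟩ := psi_eq hk h'
  have hgg : g = g' := eq_of_toV_eq (by rw [← hg, ← hg', e]) (by rw [hs, hs'])
  apply beads_injective
  ext m
  by_cases h1 : -r < m ∧ m ≤ c
  · have h2 := hm m
    rw [hgg, hm' m] at h2
    have h3 : weightInd k c ((affPerm k (readElt k ν' ⊥))⁻¹ m) =
        weightInd k c ((affPerm k (readElt k ν ⊥))⁻¹ m) := by exact_mod_cast h2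
    rcases weightInd_inv_readElt hk h h1.1 h1.2 with ⟨h4, h5⟩ | ⟨h4, h5⟩ <;>
    rcases weightInd_inv_readElt hk h' h1.1 h1.2 with ⟨h6, h7⟩ | ⟨h6, h7⟩
    · exact iff_of_true h5 h7
    · omega
    · omega
    · exact iff_of_false h5 h7
  · rw [mem_beads_iff_of_mem_partsIn h, mem_beads_iff_of_mem_partsIn h']
    constructor
    · rintro (h2 | ⟨h2, -⟩) <;> left <;> omega
    · rintro (h2 | ⟨h2, -⟩) <;> left <;> omega

omit [NeZero k] in
/-- The integers of a window represent each residue once. -/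
theorem sum_window {c r : ℕ} (hk : r + c = k + 1) (f : ZMod (k + 1) → ℝ) :
    ∑ m ∈ Finset.Ioc (-r : ℤ) c, f ((m - 1 : ℤ) : ZMod (k + 1)) = ∑ x, f x := by
  have hk' : (r : ℤ) + c = k + 1 := by exact_mod_cast hk
  refine Finset.sum_bij (fun m _ => ((m - 1 : ℤ) : ZMod (k + 1))) (fun _ _ => Finset.mem_univ _)
    (fun m hm m' hm' e => ?_) (fun x _ => ?_) (fun _ _ => rfl)
  · obtain ⟨t, ht⟩ := intCast_eq_intCast_iff.1 e
    rw [Finset.mem_Ioc] at hm hm'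
    rcases lt_trichotomy t 0 with h | h | h
    · nlinarith
    · subst h; omega
    · nlinarith
  · obtain ⟨m, rfl⟩ := ZMod.intCast_surjective x
    obtain ⟨y, t, h1, h2, e⟩ := exists_eq_add_period (k := k) (-r) (m + 1)
    refine ⟨y, Finset.mem_Ioc.2 ⟨h1, by omega⟩, ?_⟩
    exact intCast_eq_intCast_iff.2 ⟨t, by linear_combination e⟩

/-- Every set of `r` integers in the window `(-r, c]` consists of the first `r` beads of a
partition in `(c^r)`. -/
theorem exists_mem_partsIn_beads {c r : ℕ} {S : Finset ℤ} (hS : S.card = r)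
    (hw : ∀ m ∈ S, -r < m ∧ m ≤ c) :
    ∃ ν ∈ partsIn c r, ∀ m : ℤ, -r < m → m ≤ c → (m ∈ beads ν ↔ m ∈ S) := by
  set e := S.orderEmbOfFin hS with he
  -- the elements of `S` in decreasing order, then `-r, -r - 1, …`
  let B : ℕ → ℤ := fun i => if h : i < r then e ⟨r - 1 - i, by omega⟩ else -i
  have hB : ∀ i (h : i < r), B i = e ⟨r - 1 - i, by omega⟩ := fun i h => dif_pos h
  have hB' : ∀ i, r ≤ i → B i = -i := fun i h => dif_neg (by omega)
  have hBw : ∀ i < r, -r < B i ∧ B i ≤ c := by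
    intro i hi
    rw [hB i hi]
    exact hw _ (S.orderEmbOfFin_mem hS _)
  have hanti : ∀ i, B (i + 1) < B i := by
    intro i
    rcases lt_or_ge (i + 1) r with h | h
    · rw [hB _ h, hB i (by omega)]
      exact e.strictMono (Fin.mk_lt_mk.2 (by omega))
    · rw [hB' _ h]
      rcases lt_or_ge i r with h' | h'
      · have := (hBw i h').1; omega
      · rw [hB' _ h']; omega
  have hup : ∀ i, B i ≤ c - i := by
    intro i
    induction i with
    | zero =>
      rcases lt_or_ge 0 r with h | h
      · simpa using (hBw 0 h).2
      · rw [hB' 0 h]; omega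
    | succ i ih => have := hanti i; omega
  have hlow : ∀ t, ∀ i, r ≤ i + t → -(i : ℤ) ≤ B i := by
    intro t
    induction t with
    | zero => intro i h; rw [hB' i h]
    | succ t ih =>
      intro i h
      have := ih (i + 1) (by omega)
      have := hanti i
      push_cast at *; omega
  have hpos : ∀ i : ℕ, -(i : ℤ) ≤ B i := fun i => hlow r i (by omega)
  have hρ : Antitone fun i => (B i + i).toNat := by
    refine antitone_nat_of_succ_le fun i => ?_
    have := hanti i
    push_cast; omega
  refine ⟨ofRows c r _ hρ, ofRows_mem_partsIn c r _ hρ, fun m hm hm' => ?_⟩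
  have hrow : ∀ i, ((ofRows c r _ hρ).rowLen i : ℤ) - i = B i := by
    intro i
    rw [rowLen_ofRows hρ (fun i => by have := hup i; omega) (fun i h => by rw [hB' i h]; omega)]
    have := hpos i
    omega
  rw [beads]
  simp only [hrow]
  constructor
  · rintro ⟨i, rfl⟩
    have hi : i < r := by
      by_contra h
      simp only [hB' i (by omega)] at hm; omega
    simp only [hB i hi]
    exact S.orderEmbOfFin_mem hS _
  · intro h
    have : m ∈ Set.range e := by rw [he, Finset.range_orderEmbOfFin]; exact h
    obtain ⟨⟨j, hj⟩, rfl⟩ := this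
    refine ⟨r - 1 - j, ?_⟩
    simp only
    rw [hB _ (by omega)]
    congr 2; omega

theorem surjOn_psi {c r : ℕ} (hk : r + c = k + 1) :
    Set.SurjOn (psi k c) (partsIn c r) (Gam k c) := by
  classical
  have hk' : (r : ℤ) + c = k + 1 := by exact_mod_cast hk
  rintro _ ⟨g, ⟨h01, hs⟩, rfl⟩
  set S := (Finset.Ioc (-r : ℤ) c).filter fun m => g ((m - 1 : ℤ) : ZMod (k + 1)) = 0 with hSdef
  have hS : S.card = r := by
    rw [← sum_window hk, Finset.sum_congr rfl (g := fun m : ℤ => (1 : ℝ) -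
      if g ((m - 1 : ℤ) : ZMod (k + 1)) = 0 then 1 else 0) (fun m _ => by
        rcases h01 ((m - 1 : ℤ) : ZMod (k + 1)) with h | h <;> simp only [h] <;> norm_num),
      Finset.sum_sub_distrib, Finset.sum_boole, ← hSdef, Finset.sum_const, Int.card_Ioc,
      show ((c : ℤ) - -r).toNat = r + c by omega, nsmul_one] at hs
    push_cast at hs
    have : (S.card : ℝ) = r := by linarith
    exact_mod_cast this
  obtain ⟨ν, hν, hb⟩ := exists_mem_partsIn_beads (c := c) hS fun m hm =>
    Finset.mem_Ioc.1 (Finset.mem_filter.1 hm).1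
  refine ⟨ν, hν, ?_⟩
  obtain ⟨g', hg', -, -, hm'⟩ := psi_eq hk hν
  rw [hg']
  congr 1
  funext x
  obtain ⟨m, rfl⟩ := ZMod.intCast_surjective x
  obtain ⟨y, t, h1, h2, e⟩ := exists_eq_add_period (k := k) (-r) (m + 1)
  have hx : (m : ZMod (k + 1)) = ((y - 1 : ℤ) : ZMod (k + 1)) :=
    intCast_eq_intCast_iff.2 ⟨-t, by linear_combination -e⟩
  have h3 := hb y h1 (by omega)
  rw [hx, hm']
  rcases weightInd_inv_readElt hk hν h1 (by omega) with ⟨h4, h5⟩ | ⟨h4, h5⟩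
  · rw [h4, (Finset.mem_filter.1 (h3.1 h5)).2, Int.cast_zero]
  · rw [h4, Int.cast_one]
    refine ((h01 _).resolve_left fun h6 => h5 (h3.2 ?_)).symm
    exact Finset.mem_filter.2 ⟨Finset.mem_Ioc.2 ⟨h1, by omega⟩, h6⟩

theorem bijOn_psi {c r : ℕ} (hk : r + c = k + 1) :
    Set.BijOn (psi k c) (partsIn c r) (Gam k c) :=
  ⟨mapsTo_psi hk, injOn_psi hk, surjOn_psi hk⟩

end AffineA

theorem theorem3p9 (K : Type*) [CommRing K] (k : ℕ) [NeZero k] (c r : ℕ) (hc : 1 ≤ c) (hr : 1 ≤ r)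
    (hk : r + c = k + 1) :
    XR K k c r = YR K k c ∧
    (∀ ν ∈ partsIn c r, ∃! w : AffineWeyl k, IsCoreRep k ν w) ∧
    (∀ γ ∈ Gam k c, ∃! y : AffineWeyl k, IsPseudoTranslation k y 1 γ) ∧
    Set.BijOn (psi k c) (partsIn c r) (Gam k c) ∧
    (∀ ν ∈ partsIn c r, readElt k (stack c r ν) ν = pseudoTrans k (psi k c ν)) := by
  have key : ∀ ν ∈ partsIn c r, readElt k (stack c r ν) ν = pseudoTrans k (psi k c ν) :=
    fun ν h => (pseudoTrans_eq (isPseudoTranslation_readElt_stack hk h)).symm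
  refine ⟨?_, fun ν h => ⟨_, isCoreRep_readElt hk h, fun w hw => hw.unique (isCoreRep_readElt hk h)⟩,
    fun γ hγ => ?_, bijOn_psi hk, key⟩
  · refine Finset.sum_nbij (psi k c) (fun ν h => ?_) ?_ ?_ (fun ν h => ?_)
    · rw [Set.Finite.mem_toFinset] at h ⊢
      exact mapsTo_psi hk h
    · rw [Set.Finite.coe_toFinset]
      exact injOn_psi hk
    · rw [Set.Finite.coe_toFinset, Set.Finite.coe_toFinset]
      exact surjOn_psi hk
    · rw [key ν ((Set.Finite.mem_toFinset _).1 h)]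
  · obtain ⟨ν, h, rfl⟩ := surjOn_psi hk hγ
    exact ⟨_, isPseudoTranslation_readElt_stack hk h,
      fun y hy => hy.unique (isPseudoTranslation_readElt_stack hk h)⟩
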